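/- Let $S=\bar S\smallsetminus R$, where $\bar S$ is a connected compact oriented surface of genus $g$ with $k\ge 1$ boundary components and $R\subset\partial\bar S$ is a finite set of $r$ points, $4g-4+2k+r>0$. Let $\mathcal T$ be an ideal triangulation of $S$ (one vertex on each component of $\partial S$), and let $n$ be a natural number. The quiver $\Gamma_{\mathcal T}$ has one vertex near each side of each triangle ($V$ is the set of vertices); its arrows are the set $A_3$ of the arrows that form, in each triangle, a clockwise $3$-cycle through its three vertices, and the set $A_2$ of the arrows that form, across each internal edge, a $2$-cycle between the two adjacent vertices. An arrow $a$ goes from $v^-(a)$ to $v^+(a)$. A framed twisted $\mathrm{Sp}(2n,\mathbf R)$-local system on $\Gamma_{\mathcal T}$ consists of symplectic isomorphisms $g_a\colon F_{v^-(a)}\to F_{v^+(a)}$ between symplectic vector spaces $F_v$ of dimension $2n$, whose product along each $2$-cycle of $A_2$ and along each $3$-cycle of $A_3$ is $-\mathrm{Id}$, and of Lagrangians $L^t_v,L^b_v\subset F_v$ with $g_a(L^t_{v^-(a)})=L^b_{v^+(a)}$ and $g_a(L^b_{v^-(a)})=L^t_{v^+(a)}$ for $a\in A_2$, and $g_a(L^b_{v^-(a)})=L^t_{v^+(a)}$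 for $a\in A_3$. The moduli space of their equivalence classes carries the quotient topology. Such a system corresponds to a framed twisted local system on $S$; it is called maximal if there is an ideal triangulation of $S$ such that, for each of its triangles, the triple of Lagrangians at the vertices (in counterclockwise order) has Maslov index $n$. Let $\mathcal M^f_\delta(\Gamma_{\mathcal T},\mathrm{Sp}(2n,\mathbf R))$ be the space of equivalence classes of maximal ones. Let $\Delta_n$ be the set of diagonal $n\times n$ matrices with positive nondecreasing diagonal entries, and let $\mathcal X^+_\Delta(\mathcal T,n)$ be the space of the families $x=(x(a))_{a\in A_2\sqcup A_3}$ with $x(a)\in\Delta_n$ for $a\in A_2$ and $x(a)\in \mathrm O(n)$ for $a\in A_3$, such that $x(a)=x(a')$ for each $2$-cycle $(a,a')$ in $A_2$ and $x(a_3)x(a_2)x(a_1)=\mathrm{Id}$ for each $3$-cycle $(a_1,a_2,a_3)$ in $A_3$. Let $\mathrm{hol}(x)$ be the class of the system with $F_v=\mathbf R^{2n}$, $L^t_v=\mathrm{Span}(e_1,\dots,e_n)$, $L^b_v=\mathrm{Span}(f_1,\dots,f_n)$ for the standard symplectic basis $(e_1,\dots,e_n,f_1,\dots,f_n)$, and with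 transition matrices $$\begin{pmatrix}0&-x(a)^{-1/2}\\ x(a)^{1/2}&0\end{pmatrix}\ (a\in A_2),\qquad \begin{pmatrix}x(a)&-x(a)\\ x(a)&0\end{pmatrix}\ (a\in A_3).$$ Then $\mathrm{hol}$ takes its values in $\mathcal M^f_\delta(\Gamma_{\mathcal T},\mathrm{Sp}(2n,\mathbf R))$, and: 1. The map $\mathrm{hol}\colon \mathcal X^+_\Delta(\mathcal T,n)\to\mathcal M^f_\delta(\Gamma_{\mathcal T},\mathrm{Sp}(2n,\mathbf R))$ is surjective. 2. For $x,x'\in\mathcal X^+_\Delta(\mathcal T,n)$, one has $\mathrm{hol}(x)=\mathrm{hol}(x')$ if and only if $x(a)=x'(a)$ for every $a\in A_2$ and there is a family $(r_v)_{v\in V}$ of orthogonal matrices such that, for all $a\in A_2$, $r_{v^-(a)}=r_{v^+(a)}$ and this matrix commutes with $x(a)$, and, for all $a\in A_3$, $x'(a)=r_{v^+(a)}\,x(a)\,r_{v^-(a)}^{-1}$. 3. The map $\mathrm{hol}\colon \mathcal X^+_\Delta(\mathcal T,n)\to\mathcal M^f_\delta(\Gamma_{\mathcal T},\mathrm{Sp}(2n,\mathbf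 R))$ is proper. 4. If $R=\emptyset$, this map is generically finite-to-one: there is a dense open subset of $\mathcal M^f_\delta(\Gamma_{\mathcal T},\mathrm{Sp}(2n,\mathbf R))$, with dense preimage in $\mathcal X^+_\Delta(\mathcal T,n)$, over each point of which the fibre is finite. -/

import Mathlib

noncomputable section

open scoped MatrixOrder

namespace FramedSp

/-! ### Symplectic linear algebra -/

/-- The space `ℝ²ⁿ`, with coordinates `inl i` along `eᵢ` and `inr i` along `fᵢ`. -/
abbrev E (n : ℕ) : Type := Fin n ⊕ Fin n → ℝ

/-- The symplectic group `Sp(2n, ℝ)`. -/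
abbrev Sp (n : ℕ) : Type := Matrix.symplecticGroup (Fin n) ℝ

/-- The orthogonal group `O(n)`. -/
abbrev On (n : ℕ) : Type := Matrix.orthogonalGroup (Fin n) ℝ

/-- The standard symplectic form, `ω(eᵢ, fⱼ) = δᵢⱼ`. -/
def omega (n : ℕ) : LinearMap.BilinForm ℝ (E n) :=
  Matrix.toBilin' (Matrix.fromBlocks 0 1 (-1) 0)

/-- Lagrangian subspaces of `ℝ²ⁿ`. -/
def IsLagrangian {n : ℕ} (L : Submodule ℝ (E n)) : Prop :=
  Module.finrank ℝ L = n ∧ ∀ x ∈ L, ∀ y ∈ L, omega n x y = 0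

/-- The Lagrangian Grassmannian. -/
def Lag (n : ℕ) : Type := {L : Submodule ℝ (E n) // IsLagrangian L}

theorem Lag.ext {n : ℕ} {L M : Lag n} (h : L.1 = M.1) : L = M := Subtype.ext h

theorem Lag.eq_of_le {n : ℕ} {L M : Lag n} (h : L.1 ≤ M.1) : L = M :=
  Lag.ext (Submodule.eq_of_le_of_finrank_eq h (L.2.1.trans M.2.1.symm))

theorem omega_eq (n : ℕ) (x y : E n) :
    omega n x y = -(x ⬝ᵥ (Matrix.J (Fin n) ℝ).mulVec y) := by
  have : (Matrix.fromBlocks 0 1 (-1) 0 : Matrix (Fin n ⊕ Fin n) (Fin n ⊕ Fin n) ℝ)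
      = -Matrix.J (Fin n) ℝ := by
    simp [Matrix.J, Matrix.fromBlocks_neg]
  rw [omega, this, Matrix.toBilin'_apply', Matrix.neg_mulVec, dotProduct_neg]

theorem omega_mulVec {n : ℕ} (g : Sp n) (x y : E n) :
    omega n (g.1.mulVec x) (g.1.mulVec y) = omega n x y := by
  rw [omega_eq, omega_eq, Matrix.mulVec_mulVec, Matrix.dotProduct_mulVec,
    ← Matrix.vecMul_transpose, Matrix.vecMul_vecMul, ← Matrix.dotProduct_mulVec,
    ← Matrix.mul_assoc, SymplecticGroup.mem_iff'.1 g.2]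

theorem mulVec_injective {n : ℕ} (g : Sp n) : Function.Injective g.1.mulVecLin := by
  intro x y h
  have h2 := congrArg (g⁻¹ : Sp n).1.mulVec h
  simp only [Matrix.mulVecLin_apply, Matrix.mulVec_mulVec] at h2
  have h3 : (g⁻¹ : Sp n).1 * g.1 = 1 := congrArg Subtype.val (inv_mul_cancel g)
  simpa [h3] using h2

/-- `Sp(2n, ℝ)` acts on Lagrangians by taking images. -/
instance (n : ℕ) : MulAction (Sp n) (Lag n) where
  smul g L := ⟨L.1.map g.1.mulVecLin, by
    refine ⟨?_, ?_⟩
    · exact (Submodule.equivMapOfInjective _ (mulVec_injective g) L.1).finrank_eq.symm.trans L.2.1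
    · rintro _ ⟨x, hx, rfl⟩ _ ⟨y, hy, rfl⟩
      exact (omega_mulVec g x y).trans (L.2.2 x hx y hy)⟩
  one_smul L := Lag.ext (by
    change L.1.map (1 : Matrix _ _ ℝ).mulVecLin = L.1
    simp)
  mul_smul g h L := Lag.ext (by
    change L.1.map (g.1 * h.1).mulVecLin = (L.1.map h.1.mulVecLin).map g.1.mulVecLin
    rw [Matrix.mulVecLin_mul, Submodule.map_comp])

/-- `Sp(2n, ℝ)` acts on Lagrangians: membership in `g • L`. -/
theorem mem_smul_lag {n : ℕ} (g : Sp n) (L : Lag n) (y : E n) :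
    y ∈ (g • L).1 ↔ ∃ x ∈ L.1, g.1.mulVec x = y := Iff.rfl

theorem isLagrangian_span {n : ℕ} {j : Fin n → Fin n ⊕ Fin n} (hj : Function.Injective j)
    (h : ∀ i k, omega n (Pi.single (j i) 1) (Pi.single (j k) 1) = 0) :
    IsLagrangian (Submodule.span ℝ (Set.range fun i => (Pi.single (j i) 1 : E n))) := by
  constructor
  · have hli : LinearIndependent ℝ (fun i => (Pi.single (j i) 1 : E n)) := by
      have := (Pi.basisFun ℝ (Fin n ⊕ Fin n)).linearIndependent.comp j hj
      simpa [Function.comp_def] using this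
    simpa using finrank_span_eq_card hli
  · intro x hx y hy
    induction hx, hy using Submodule.span_induction₂ with
    | mem_mem x y hx hy =>
      obtain ⟨i, rfl⟩ := hx
      obtain ⟨k, rfl⟩ := hy
      exact h i k
    | zero_left y hy => simp
    | zero_right x hx => simp
    | add_left x y z _ _ _ h1 h2 => simp [h1, h2]
    | add_right x y z _ _ _ h1 h2 => simp [h1, h2]
    | smul_left r x y _ _ h1 => simp [h1]
    | smul_right r x y _ _ h1 => simp [h1]

/-- `Span(e₁, …, eₙ)`. -/
def spanE (n : ℕ) : Lag n :=
  ⟨Submodule.span ℝ (Set.range fun i => (Pi.single (Sum.inl i) 1 : E n)),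
    isLagrangian_span Sum.inl_injective fun i k => by
      simp [omega, Matrix.toBilin'_single]⟩

/-- `Span(f₁, …, fₙ)`. -/
def spanF (n : ℕ) : Lag n :=
  ⟨Submodule.span ℝ (Set.range fun i => (Pi.single (Sum.inr i) 1 : E n)),
    isLagrangian_span Sum.inr_injective fun i k => by
      simp [omega, Matrix.toBilin'_single]⟩

theorem mem_spanE {n : ℕ} {x : E n} : x ∈ (spanE n).1 ↔ ∀ i, x (Sum.inr i) = 0 := by
  constructor
  · intro hx i
    induction hx using Submodule.span_induction with
    | mem y hy => obtain ⟨k, rfl⟩ := hy; simp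
    | zero => rfl
    | add y z _ _ h1 h2 => simp [h1, h2]
    | smul r y _ h1 => simp [h1]
  · intro hx
    have : x = ∑ i, x (Sum.inl i) • (Pi.single (Sum.inl i) 1 : E n) := by
      ext (k | k)
      · simp [Finset.sum_apply, Pi.single_apply]
      · simp [Finset.sum_apply, hx]
    rw [this]
    exact Submodule.sum_mem _ fun i _ => Submodule.smul_mem _ _ (Submodule.subset_span ⟨i, rfl⟩)

theorem mem_spanF {n : ℕ} {x : E n} : x ∈ (spanF n).1 ↔ ∀ i, x (Sum.inl i) = 0 := by
  constructor
  · intro hx i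
    induction hx using Submodule.span_induction with
    | mem y hy => obtain ⟨k, rfl⟩ := hy; simp
    | zero => rfl
    | add y z _ _ h1 h2 => simp [h1, h2]
    | smul r y _ h1 => simp [h1]
  · intro hx
    have : x = ∑ i, x (Sum.inr i) • (Pi.single (Sum.inr i) 1 : E n) := by
      ext (k | k)
      · simp [Finset.sum_apply, hx]
      · simp [Finset.sum_apply, Pi.single_apply]
    rw [this]
    exact Submodule.sum_mem _ fun i _ => Submodule.smul_mem _ _ (Submodule.subset_span ⟨i, rfl⟩)

/-- The topology of the Lagrangian Grassmannian as the homogeneous space `Sp(2n, ℝ) / P`, where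
`P` is the stabilizer of `Span(e)`. -/
instance (n : ℕ) : TopologicalSpace (Lag n) :=
  TopologicalSpace.coinduced (fun g : Sp n => g • spanE n) inferInstance

/-- The quadratic form `(v, w, x) ↦ ω(v, w) + ω(w, x) + ω(x, v)` on `L₁ ⊕ M ⊕ L₂`. -/
def maslovForm {n : ℕ} (L₁ M L₂ : Lag n) : QuadraticForm ℝ (L₁.1 × M.1 × L₂.1) :=
  let p₁ := L₁.1.subtype ∘ₗ LinearMap.fst ℝ L₁.1 (M.1 × L₂.1)
  let p₂ := M.1.subtype ∘ₗ LinearMap.fst ℝ M.1 L₂.1 ∘ₗ LinearMap.snd ℝ L₁.1 (M.1 × L₂.1)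
  let p₃ := L₂.1.subtype ∘ₗ LinearMap.snd ℝ M.1 L₂.1 ∘ₗ LinearMap.snd ℝ L₁.1 (M.1 × L₂.1)
  LinearMap.BilinMap.toQuadraticMap
    ((omega n).compl₁₂ p₁ p₂ + (omega n).compl₁₂ p₂ p₃ + (omega n).compl₁₂ p₃ p₁)

/-- The Maslov index of a triple of Lagrangians: the signature of `maslovForm`. -/
def maslovIndex {n : ℕ} (L₁ M L₂ : Lag n) : ℤ :=
  (sigPos (maslovForm L₁ M L₂) : ℤ) - sigNeg (maslovForm L₁ M L₂)

/-! ### Ideal triangulations and their quivers -/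

/-- An ideal triangulation of a connected oriented surface, presented by gluing oriented triangles
along sides. `V` is the set of sides of the triangles (pairs of a face and one of its three edges).
`next` goes clockwise to the following side of the same face, so that the faces are the orbits of
`next`; `opp` sends a side of a face to the side it is glued to (by the orientation reversing
identification), and fixes the sides that are not glued, that is, the external edges.
The orbits of corners of the triangles are the vertices of the triangulation, that is, the
components of the boundary of the surface. -/
structure IdealTriangulation (V : Type*) where
  next : Equiv.Perm V
  opp : Equiv.Perm V
  next_next_next : ∀ v, next (next (next v)) = v
  next_ne : ∀ v, next v ≠ v
  opp_opp : ∀ v, opp (opp v) = v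
  connected : ∀ v w, ∃ g ∈ Subgroup.closure {next, opp}, g v = w

namespace IdealTriangulation

variable {V : Type*}

/-- The quiver of the triangulation has vertex set `V` (one vertex near each side of each face).
`A₂` is the set of its arrows crossing an internal edge: one arrow `v → opp v` for every side `v`
with `opp v ≠ v`. The arrows inside the faces are the arrows `v → next v`, one for every `v`; their
set `A₃` is identified with `V` by taking start points. -/
abbrev A₂ (T : IdealTriangulation V) : Type _ := {v : V // T.opp v ≠ v}

/-- Start point of an arrow in `A₂`. -/
def src {T : IdealTriangulation V} (a : T.A₂) : V := a.1

/-- End point of an arrow in `A₂`. -/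
def tgt {T : IdealTriangulation V} (a : T.A₂) : V := T.opp a.1

/-- The other arrow of the `2`-cycle containing an arrow of `A₂`. -/
def rev {T : IdealTriangulation V} (a : T.A₂) : T.A₂ :=
  ⟨T.opp a.1, fun h => a.2 (by rw [T.opp_opp] at h; exact h.symm)⟩

/-- `T'` is obtained from `T` by flipping the internal edge with sides `v` and `w = opp v`, which
belong to two different faces. The faces `(v, a, b)` and `(w, c, d)` (sides listed clockwise) form
a quadrilateral with sides `a, b, c, d` (listed clockwise); they are replaced with the faces
`(v, b, c)` and `(w, d, a)`, where `v` and `w` now are the two sides of the other diagonal. -/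
structure IsFlip (T T' : IdealTriangulation V) (v : V) : Prop where
  internal : T.opp v ≠ v
  ne_next : T.opp v ≠ T.next v
  ne_next_next : T.opp v ≠ T.next (T.next v)
  opp_eq : T'.opp = T.opp
  next_v : T'.next v = T.next (T.next v)
  next_b : T'.next (T.next (T.next v)) = T.next (T.opp v)
  next_c : T'.next (T.next (T.opp v)) = v
  next_w : T'.next (T.opp v) = T.next (T.next (T.opp v))
  next_d : T'.next (T.next (T.next (T.opp v))) = T.next v
  next_a : T'.next (T.next v) = T.opp v
  next_other : ∀ u, u ≠ v → u ≠ T.next v → u ≠ T.next (T.next v) →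
    u ≠ T.opp v → u ≠ T.next (T.opp v) → u ≠ T.next (T.next (T.opp v)) → T'.next u = T.next u

theorem IsFlip.internal' {T T' : IdealTriangulation V} {v : V} (h : IsFlip T T' v) :
    T'.opp v ≠ v := by rw [h.opp_eq]; exact h.internal

end IdealTriangulation

open IdealTriangulation

variable {V : Type*}

/-! ### Framed twisted symplectic local systems on the quiver -/

/-- A framed `δ`-twisted `Sp(2n, ℝ)`-local system on the quiver of `T`, with all the fibres
identified with the standard symplectic space `ℝ²ⁿ`. -/
@[ext]
structure FramedLocalSystem (T : IdealTriangulation V) (n : ℕ) where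
  /-- transition map of an arrow in `A₂` -/
  edge : T.A₂ → Sp n
  /-- transition map of the arrow `v → next v` in `A₃` -/
  tri : V → Sp n
  /-- the Lagrangians `Lᵗ` -/
  Lt : V → Lag n
  /-- the Lagrangians `Lᵇ` -/
  Lb : V → Lag n
  edge_twisted : ∀ a : T.A₂, (edge (rev a)).1 * (edge a).1 = -1
  tri_twisted : ∀ v, (tri (T.next (T.next v))).1 * (tri (T.next v)).1 * (tri v).1 = -1
  edge_Lt : ∀ a : T.A₂, edge a • Lt (src a) = Lb (tgt a)
  edge_Lb : ∀ a : T.A₂, edge a • Lb (src a) = Lt (tgt a)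
  tri_Lb : ∀ v, tri v • Lb v = Lt (T.next v)

namespace FramedLocalSystem

variable {T T' : IdealTriangulation V} {n : ℕ}

/-- Equivalence of framed local systems. -/
def Equivalent (F F' : FramedLocalSystem T n) : Prop :=
  ∃ ψ : V → Sp n,
    (∀ a : T.A₂, F'.edge a * ψ (src a) = ψ (tgt a) * F.edge a) ∧
    (∀ v, F'.tri v * ψ v = ψ (T.next v) * F.tri v) ∧
    (∀ v, ψ v • F.Lt v = F'.Lt v) ∧
    (∀ v, ψ v • F.Lb v = F'.Lb v)

instance setoid (T : IdealTriangulation V) (n : ℕ) : Setoid (FramedLocalSystem T n) where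
  r := Equivalent
  iseqv :=
    { refl := fun F => ⟨fun _ => 1, by simp, by simp, by simp, by simp⟩
      symm := by
        rintro F F' ⟨ψ, h1, h2, h3, h4⟩
        refine ⟨fun v => (ψ v)⁻¹, fun a => ?_, fun v => ?_, fun v => ?_, fun v => ?_⟩
        · rw [eq_inv_mul_iff_mul_eq, ← mul_assoc, ← h1 a, mul_inv_cancel_right]
        · rw [eq_inv_mul_iff_mul_eq, ← mul_assoc, ← h2 v, mul_inv_cancel_right]
        · rw [← h3 v, inv_smul_smul]
        · rw [← h4 v, inv_smul_smul]
      trans := by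
        rintro F F' F'' ⟨ψ, h1, h2, h3, h4⟩ ⟨φ, k1, k2, k3, k4⟩
        refine ⟨fun v => φ v * ψ v, fun a => ?_, fun v => ?_, fun v => ?_, fun v => ?_⟩
        · rw [← mul_assoc, k1 a, mul_assoc, h1 a, mul_assoc]
        · rw [← mul_assoc, k2 v, mul_assoc, h2 v, mul_assoc]
        · rw [mul_smul, h3 v, k3 v]
        · rw [mul_smul, h4 v, k4 v] }

/-- The topology on framed local systems as tuples of matrices and Lagrangians. -/
instance (T : IdealTriangulation V) (n : ℕ) : TopologicalSpace (FramedLocalSystem T n) :=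
  TopologicalSpace.induced (fun F => (F.edge, F.tri, F.Lt, F.Lb)) inferInstance

/-- For every triangle of `T`, the Maslov index of the triple of Lagrangians at its vertices,
in counterclockwise order, is `n`. The triple is seen from the endpoint of each of the three arrows
contained in the triangle. -/
def AllMaslovMaximal (F : FramedLocalSystem T n) : Prop :=
  ∀ v, maslovIndex (F.Lt (T.next v)) (F.tri v • F.Lt v) (F.Lb (T.next v)) = n

/-- `F` on `T` and `F'` on the flipped triangulation `T'` are the restrictions to the two quivers of
the same framed twisted local system on the surface. The fibres at the sides other than
the two sides of the flipped edge are the same, and parallel transport around each of the four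
corners of the quadrilateral is the same. -/
structure IsFlip (F : FramedLocalSystem T n) (F' : FramedLocalSystem T' n) (v : V) : Prop where
  flip : T.IsFlip T' v
  edge_eq : ∀ (u : V) (h : T.opp u ≠ u) (h' : T'.opp u ≠ u), u ≠ v → u ≠ T.opp v →
    F'.edge ⟨u, h'⟩ = F.edge ⟨u, h⟩
  tri_eq : ∀ u, u ≠ v → u ≠ T.next v → u ≠ T.next (T.next v) →
    u ≠ T.opp v → u ≠ T.next (T.opp v) → u ≠ T.next (T.next (T.opp v)) → F'.tri u = F.tri u
  Lt_eq : ∀ u, u ≠ v → u ≠ T.opp v → F'.Lt u = F.Lt u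
  Lb_eq : ∀ u, u ≠ v → u ≠ T.opp v → F'.Lb u = F.Lb u
  corner_b : F'.tri (T.next (T.next v)) =
    F.tri (T.opp v) * F.edge ⟨v, flip.internal⟩ * F.tri (T.next (T.next v))
  corner_d : F'.tri (T.next (T.next (T.opp v))) =
    F.tri v * F.edge (rev ⟨v, flip.internal⟩) * F.tri (T.next (T.next (T.opp v)))
  corner_a : F.tri (T.next v) =
    F'.tri v * F'.edge (rev ⟨v, flip.internal'⟩) * F'.tri (T.next v)
  corner_c : F.tri (T.next (T.opp v)) =
    F'.tri (T.opp v) * F'.edge ⟨v, flip.internal'⟩ * F'.tri (T.next (T.opp v))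

/-- One flip, together with the corresponding change of the framed local system. -/
def FlipStep (n : ℕ) (p q : Σ T : IdealTriangulation V, FramedLocalSystem T n) : Prop :=
  ∃ v, IsFlip p.2 q.2 v

/-- A framed twisted local system is maximal if there is an ideal triangulation of the surface (that
is, one that is obtained from `T` by a sequence of flips) for which the Maslov indices of
all the triangles are equal to `n`. -/
def IsMaximal (F : FramedLocalSystem T n) : Prop :=
  ∃ p : Σ T : IdealTriangulation V, FramedLocalSystem T n,
    Relation.ReflTransGen (FlipStep n) ⟨T, F⟩ p ∧ p.2.AllMaslovMaximal

end FramedLocalSystem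

/-- The moduli space of framed `δ`-twisted symplectic local systems on the quiver of `T`,
with the quotient topology. -/
abbrev Moduli (T : IdealTriangulation V) (n : ℕ) : Type _ :=
  Quotient (FramedLocalSystem.setoid T n)

/-- The space of maximal framed twisted local systems. -/
def maximalModuli (T : IdealTriangulation V) (n : ℕ) : Set (Moduli T n) :=
  {c | ∃ F : FramedLocalSystem T n, F.IsMaximal ∧ (⟦F⟧ : Moduli T n) = c}

/-! ### Coordinates -/

/-- The space `𝒳⁺(T, n)`: the first component is the family `(x(a))` for `a ∈ A₂`, the second one
is the family `(x(a))` for `a ∈ A₃`. -/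
abbrev XPlus (T : IdealTriangulation V) (n : ℕ) : Type _ :=
  {x : (T.A₂ → Matrix (Fin n) (Fin n) ℝ) × (V → On n) //
    (∀ a, (x.1 a).PosDef) ∧ (∀ a, x.1 (rev a) = x.1 a) ∧
    ∀ v, x.2 (T.next (T.next v)) * x.2 (T.next v) * x.2 v = 1}

/-- Diagonal matrices with positive nondecreasing entries. -/
def Delta (n : ℕ) : Set (Matrix (Fin n) (Fin n) ℝ) :=
  {D | ∃ d : Fin n → ℝ, (∀ i, 0 < d i) ∧ Monotone d ∧ D = Matrix.diagonal d}

/-- The space `𝒳⁺_Δ(T, n)` of positive (diagonal) `𝒳`-coordinates. -/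
abbrev XPlusDelta (T : IdealTriangulation V) (n : ℕ) : Type _ :=
  {x : XPlus T n // ∀ a, x.1.1 a ∈ Delta n}

section holonomy

variable {n : ℕ}

theorem sqrt_mul_sqrt {S : Matrix (Fin n) (Fin n) ℝ} (hS : S.PosDef) :
    CFC.sqrt S * CFC.sqrt S = S :=
  CFC.sqrt_mul_sqrt_self S hS.posSemidef.nonneg

theorem sqrt_transpose (S : Matrix (Fin n) (Fin n) ℝ) : (CFC.sqrt S).transpose = CFC.sqrt S := by
  have := (Matrix.nonneg_iff_posSemidef.1 (CFC.sqrt_nonneg S)).isHermitian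
  simpa [Matrix.IsHermitian] using this

theorem sqrt_isUnit_det {S : Matrix (Fin n) (Fin n) ℝ} (hS : S.PosDef) :
    IsUnit (CFC.sqrt S).det := by
  have h : IsUnit ((CFC.sqrt S).det * (CFC.sqrt S).det) := by
    rw [← Matrix.det_mul, sqrt_mul_sqrt hS]
    exact (Matrix.isUnit_iff_isUnit_det _).1 hS.isUnit
  exact isUnit_of_mul_isUnit_left h

/-- The matrix with blocks `0, -S^{-1/2}; S^{1/2}, 0`. -/
def edgeMatrix (S : Matrix (Fin n) (Fin n) ℝ) (hS : S.PosDef) : Sp n :=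
  ⟨Matrix.fromBlocks 0 (-(CFC.sqrt S)⁻¹) (CFC.sqrt S) 0, by
    have hu := sqrt_isUnit_det hS
    rw [SymplecticGroup.mem_iff, Matrix.J, Matrix.fromBlocks_transpose,
      Matrix.fromBlocks_multiply, Matrix.fromBlocks_multiply]
    simp [Matrix.transpose_nonsing_inv, sqrt_transpose, Matrix.nonsing_inv_mul _ hu,
      Matrix.mul_nonsing_inv _ hu]⟩

/-- The matrix with blocks `u, -u; u, 0`. -/
def triMatrix (u : On n) : Sp n :=
  ⟨Matrix.fromBlocks u.1 (-u.1) u.1 0, by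
    have hu : u.1 * u.1.transpose = 1 := by
      have := (Matrix.mem_orthogonalGroup_iff (Fin n) ℝ).1 u.2
      simpa [Matrix.star_eq_conjTranspose] using this
    rw [SymplecticGroup.mem_iff, Matrix.J, Matrix.fromBlocks_transpose,
      Matrix.fromBlocks_multiply, Matrix.fromBlocks_multiply]
    simp [hu]⟩

theorem fromBlocks_mulVec_inl (A B C D : Matrix (Fin n) (Fin n) ℝ) (x : E n) (i : Fin n) :
    (Matrix.fromBlocks A B C D).mulVec x (Sum.inl i) =
      A.mulVec (x ∘ Sum.inl) i + B.mulVec (x ∘ Sum.inr) i := by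
  rw [Matrix.fromBlocks_mulVec]; rfl

theorem fromBlocks_mulVec_inr (A B C D : Matrix (Fin n) (Fin n) ℝ) (x : E n) (i : Fin n) :
    (Matrix.fromBlocks A B C D).mulVec x (Sum.inr i) =
      C.mulVec (x ∘ Sum.inl) i + D.mulVec (x ∘ Sum.inr) i := by
  rw [Matrix.fromBlocks_mulVec]; rfl

theorem smul_spanE_of_block {g : Sp n} {B C D : Matrix (Fin n) (Fin n) ℝ}
    (hg : g.1 = Matrix.fromBlocks 0 B C D) : g • spanE n = spanF n := by
  refine Lag.eq_of_le fun y hy => ?_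
  obtain ⟨x, hx, rfl⟩ := (mem_smul_lag _ _ _).1 hy
  refine mem_spanF.2 fun i => ?_
  have h0 : x ∘ Sum.inr = 0 := funext (mem_spanE.1 hx)
  rw [hg, fromBlocks_mulVec_inl, h0]
  simp

theorem smul_spanF_of_block {g : Sp n} {A B C : Matrix (Fin n) (Fin n) ℝ}
    (hg : g.1 = Matrix.fromBlocks A B C 0) : g • spanF n = spanE n := by
  refine Lag.eq_of_le fun y hy => ?_
  obtain ⟨x, hx, rfl⟩ := (mem_smul_lag _ _ _).1 hy
  refine mem_spanE.2 fun i => ?_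
  have h0 : x ∘ Sum.inl = 0 := funext (mem_spanF.1 hx)
  rw [hg, fromBlocks_mulVec_inr, h0]
  simp

/-- The framed twisted local system with transition matrices `G_a(x)` and with the framing
generated by the standard symplectic basis in every fibre. -/
def holSystem (T : IdealTriangulation V) (x : XPlus T n) : FramedLocalSystem T n where
  edge a := edgeMatrix (x.1.1 a) (x.2.1 a)
  tri v := triMatrix (x.1.2 v)
  Lt _ := spanE n
  Lb _ := spanF n
  edge_twisted a := by
    have hu := sqrt_isUnit_det (x.2.1 a)
    simp only [edgeMatrix, x.2.2.1 a, Matrix.fromBlocks_multiply]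
    rw [← Matrix.fromBlocks_one, Matrix.fromBlocks_neg]
    simp [Matrix.nonsing_inv_mul _ hu, Matrix.mul_nonsing_inv _ hu]
  tri_twisted v := by
    have h : (x.1.2 (T.next (T.next v))).1 * (x.1.2 (T.next v)).1 * (x.1.2 v).1 = 1 :=
      congrArg Subtype.val (x.2.2.2 v)
    simp only [triMatrix, Matrix.fromBlocks_multiply]
    rw [← Matrix.fromBlocks_one, Matrix.fromBlocks_neg]
    simp [h]
  edge_Lt _ := smul_spanE_of_block rfl
  edge_Lb _ := smul_spanF_of_block rfl
  tri_Lb _ := smul_spanF_of_block rfl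

/-- The holonomy map on `𝒳⁺(T, n)`. -/
def hol (T : IdealTriangulation V) (n : ℕ) (x : XPlus T n) : Moduli T n :=
  ⟦holSystem T x⟧

/-- The holonomy map on `𝒳⁺_Δ(T, n)`. -/
def holDelta (T : IdealTriangulation V) (n : ℕ) (x : XPlusDelta T n) : Moduli T n :=
  hol T n x.1

/-- The holonomy map on `𝒳⁺_Δ(T, n)`, as a map to the space of maximal framed local systems, given
that it takes its values there. -/
def holDeltaMax (T : IdealTriangulation V) (n : ℕ)
    (h : ∀ x : XPlusDelta T n, holDelta T n x ∈ maximalModuli T n) :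
    XPlusDelta T n → maximalModuli T n :=
  Set.codRestrict (holDelta T n) (maximalModuli T n) h

end holonomy

/-- A map is generically finite-to-one if it has finite fibres over a dense open subset of the
target, whose preimage is moreover dense in the source. -/
def GenericallyFiniteToOne {X Y : Type*} [TopologicalSpace X] [TopologicalSpace Y]
    (f : X → Y) : Prop :=
  ∃ U : Set Y, IsOpen U ∧ Dense U ∧ Dense (f ⁻¹' U) ∧ ∀ y ∈ U, (f ⁻¹' {y}).Finite

end FramedSp

end

open FramedSp FramedSp.IdealTriangulation

noncomputable section

open scoped MatrixOrder

namespace FramedSp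

/-! ### The symplectic form and Lagrangian subspaces -/

section Lagrangian

variable {n : ℕ}

/-! A triple of Lagrangians of maximal Maslov index is positive (`posTriple_of_maslovIndex`): its
outer members are transverse and the middle one is the graph of a positive definite form. Positive
triples form a single orbit of the symplectic group (`PosTriple.exists_sp`, `maslovIndex_standard`),
and the stabilizer of the standard one is the compact group `O(n)`, embedded as `diag(r, r)`.
Everything rests on these facts.

Positivity survives flips: in a quadrilateral cut by a diagonal into two positive triangles, the
triangles of the other diagonal are positive too (`PosTriple.exchange`). So a maximal system has
positive triples on all faces of the given triangulation (`IsMaximal.posAt`).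

For surjectivity, a gauge makes every face standard, so that its arrows become `triMatrix u` with
`u` orthogonal. The remaining freedom is one orthogonal matrix per side. Across an internal edge the
transition is determined by an invertible block `C`, and the two orthogonal matrices at its ends
turn `C` into a sorted positive diagonal matrix by singular value decomposition. For the fibres, a
gauge between two normalized systems must be orthogonal, and an orthogonal pair intertwining two
sorted diagonal edge matrices forces these to be equal, the pair to be equal, and both to commute
with them (`holDelta_eq_iff`).

Properness is tested on ultrafilters. Convergence in the quotient lifts to convergence of gauged
systems. The gauges move the standard triple to triples converging to it, so they are bounded
(`exists_nhds_abs_le`) and converge, and the coordinates follow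
(`tendsto_nhds_holDelta_of_ultrafilter`).

For generic finiteness, over edge matrices with simple spectrum and with every side internal, the
commuting orthogonal matrices are diagonal with entries `±1`, hence finite in number. Properness
makes this locus open in the target. -/

theorem omega_apply (x y : E n) :
    omega n x y = x ∘ Sum.inl ⬝ᵥ y ∘ Sum.inr - x ∘ Sum.inr ⬝ᵥ y ∘ Sum.inl := by
  rw [omega, Matrix.toBilin'_apply', Matrix.fromBlocks_mulVec]
  simp [dotProduct, Fintype.sum_sum_type, sub_eq_add_neg, Matrix.neg_mulVec]

theorem omega_self (x : E n) : omega n x x = 0 := by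
  rw [omega_apply, dotProduct_comm, sub_self]

theorem omega_swap (x y : E n) : omega n y x = -omega n x y := by
  rw [omega_apply, omega_apply, dotProduct_comm, dotProduct_comm (y ∘ Sum.inr)]
  ring

theorem omega_nondegenerate : (omega n).Nondegenerate := by
  refine (LinearMap.IsRefl.nondegenerate_iff_separatingLeft fun x y h => ?_).2 fun x hx => ?_
  · rw [omega_swap, h, neg_zero]
  · ext (i | i)
    · simpa [omega_apply, dotProduct, Pi.single_apply] using hx (Pi.single (Sum.inr i) 1)
    · simpa [omega_apply, dotProduct, Pi.single_apply] using hx (Pi.single (Sum.inl i) 1)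

/-- A Lagrangian subspace contains its symplectic orthogonal. -/
theorem Lag.mem_of_omega_eq_zero (L : Lag n) {x : E n} (hx : ∀ y ∈ L.1, omega n y x = 0) :
    x ∈ L.1 := by
  have h1 := LinearMap.BilinForm.finrank_orthogonal omega_nondegenerate L.1
  have hle : L.1 ≤ (omega n).orthogonal L.1 := fun x hx y hy => L.2.2 y hy x hx
  have hE : Module.finrank ℝ (E n) = n + n := by simp
  rw [hE, L.2.1] at h1
  have := Submodule.eq_of_le_of_finrank_eq hle (by rw [L.2.1, h1]; omega)
  rw [this]
  exact hx

end Lagrangian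

/-! ### Positive triples of Lagrangians -/

/-- `M` is the graph of a map `L₁ → L₂` defining a positive definite form on `L₁`. -/
def PosTriple {n : ℕ} (L₁ M L₂ : Lag n) : Prop :=
  L₁.1 ⊓ L₂.1 = ⊥ ∧ ∀ v ∈ L₁.1, ∀ x ∈ L₂.1, v + x ∈ M.1 → v + x ≠ 0 → 0 < omega n v x

namespace PosTriple

variable {n : ℕ} {L₁ L₂ L₃ L₄ : Lag n}

theorem nonneg (h : PosTriple L₁ L₂ L₃) {v x : E n} (hv : v ∈ L₁.1) (hx : x ∈ L₃.1)
    (hw : v + x ∈ L₂.1) : 0 ≤ omega n v x := by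
  by_cases h0 : v + x = 0
  · rw [← add_eq_zero_iff_neg_eq.1 h0, map_neg, omega_self, neg_zero]
  · exact (h.2 v hv x hx hw h0).le

/-- If `m + l = x` lies in `L₃`, then `m = -l + x` is the decomposition of a vector of `L₂` along
`L₁` and `L₃`, and `ω(-l, x) = ω(m, l)`. -/
theorem rotate (h : PosTriple L₁ L₂ L₃) : PosTriple L₂ L₃ L₁ := by
  refine ⟨?_, fun m hm l hl hx hne => ?_⟩
  · rw [Submodule.eq_bot_iff]
    rintro w ⟨h2, h1⟩
    by_contra hw
    simpa using h.2 w h1 0 (zero_mem _) (by simpa using h2) (by simpa using hw)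
  · have hm0 : m ≠ 0 := by
      rintro rfl
      have : l ∈ L₁.1 ⊓ L₃.1 := ⟨hl, by simpa using hx⟩
      rw [h.1, Submodule.mem_bot] at this
      exact hne (by simp [this])
    have := h.2 (-l) (neg_mem hl) (m + l) hx (by simpa using hm) (by simpa using hm0)
    rw [omega_swap] at this
    simpa [omega_self] using this

theorem isCompl (h : PosTriple L₁ L₂ L₃) : IsCompl L₁.1 L₃.1 := by
  refine Submodule.isCompl_iff_disjoint _ _ ?_ |>.2 (disjoint_iff.2 h.1)
  rw [L₁.2.1, L₃.2.1]
  simp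

/-- If the two triangles on one side of a diagonal of a quadrilateral are positive, so are those
of the other diagonal. -/
theorem exchange (h : PosTriple L₁ L₂ L₃) (h' : PosTriple L₁ L₃ L₄) : PosTriple L₁ L₂ L₄ := by
  refine ⟨h'.1, fun v hv x hx hw hne => ?_⟩
  -- The vector of `L₂` is decomposed along `L₁ ⊕ L₃` as `v₁ + v₃`. Then `x = v₃ + (v₁ - v)`, so
  -- `ω(v, x) = ω(v, v₃)`. The first triple gives `ω(v₁, v₃) > 0` and the second `ω(v₃, v₁ - v) ≥
  -- 0`.
  obtain ⟨v₁, hv₁, v₃, hv₃, hsum⟩ := Submodule.mem_sup.1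
    (h.isCompl.sup_eq_top.symm ▸ Submodule.mem_top : v + x ∈ L₁.1 ⊔ L₃.1)
  have hp := h.2 v₁ hv₁ v₃ hv₃ (hsum ▸ hw) (hsum ▸ hne)
  have hx' : v₃ + (v₁ - v) = x := by
    rw [add_sub, add_comm v₃, hsum, add_sub_cancel_left]
  have hq := h'.rotate.nonneg hv₃ (sub_mem hv₁ hv) (hx' ▸ hx)
  have h1 := L₁.2.2 v hv v₁ hv₁
  rw [← hx']
  rw [omega_swap, map_sub, LinearMap.sub_apply] at hq
  simp only [map_add, map_sub, h1, omega_self]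
  linarith

theorem smul (g : Sp n) (h : PosTriple L₁ L₂ L₃) : PosTriple (g • L₁) (g • L₂) (g • L₃) := by
  refine ⟨?_, ?_⟩
  · rw [Submodule.eq_bot_iff]
    rintro _ ⟨⟨x, hx, rfl⟩, ⟨y, hy, hxy⟩⟩
    obtain rfl := mulVec_injective g hxy
    have : y ∈ L₁.1 ⊓ L₃.1 := ⟨hx, hy⟩
    rw [h.1, Submodule.mem_bot] at this
    simp [this]
  · rintro _ ⟨v, hv, rfl⟩ _ ⟨x, hx, rfl⟩ ⟨w, hw, hsum⟩ hne
    rw [← map_add] at hsum hne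
    obtain rfl := mulVec_injective g hsum
    exact (h.2 v hv x hx hw fun h0 => hne (by rw [h0, map_zero])).trans_eq
      (omega_mulVec g v x).symm

end PosTriple

/-! ### The Maslov index -/

section Maslov

variable {n : ℕ}

theorem le_sigPos_of_linearMap {M N : Type*} [AddCommGroup M] [Module ℝ M] [Module.Finite ℝ M]
    [AddCommGroup N] [Module ℝ N] (Q : QuadraticForm ℝ M) (f : N →ₗ[ℝ] M)
    (hf : ∀ x, x ≠ 0 → 0 < Q (f x)) : Module.finrank ℝ N ≤ sigPos Q := by
  have hinj : Function.Injective f := (injective_iff_map_eq_zero f).2 fun x hx => by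
    by_contra h
    simpa [hx] using hf x h
  rw [← LinearMap.finrank_range_of_inj hinj]
  refine le_sigPos_of_posDef Q ?_
  rintro ⟨_, x, rfl⟩ hx
  exact hf x fun h => hx (by simp [h])

theorem sigPos_add_finrank_le_of_linearMap {M N : Type*} [AddCommGroup M] [Module ℝ M]
    [Module.Finite ℝ M] [AddCommGroup N] [Module ℝ N] (Q : QuadraticForm ℝ M) (f : N →ₗ[ℝ] M)
    (hinj : Function.Injective f) (hf : ∀ x, Q (f x) ≤ 0) :
    sigPos Q + Module.finrank ℝ N ≤ Module.finrank ℝ M := by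
  rw [← LinearMap.finrank_range_of_inj hinj]
  refine QuadraticForm.sigPos_add_finrank_le_of_nonpos ?_
  rintro _ ⟨x, rfl⟩
  exact hf x

theorem maslovForm_apply (L₁ M L₂ : Lag n) (p : L₁.1 × M.1 × L₂.1) :
    maslovForm L₁ M L₂ p =
      omega n p.1 p.2.1 + omega n p.2.1 p.2.2 + omega n p.2.2 p.1 := by
  simp [maslovForm]

theorem finrank_lag_prod (L₁ M L₂ : Lag n) :
    Module.finrank ℝ (L₁.1 × M.1 × L₂.1) = 3 * n := by
  rw [Module.finrank_prod, Module.finrank_prod, L₁.2.1, M.2.1, L₂.2.1]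
  ring

/-- The triple intersection embeds in three ways in the radical of the form. -/
theorem three_mul_finrank_inf_le (L₁ M L₂ : Lag n) :
    3 * Module.finrank ℝ (L₁.1 ⊓ M.1 ⊓ L₂.1 : Submodule ℝ (E n)) ≤
      Module.finrank ℝ (maslovForm L₁ M L₂).radical := by
  set K : Submodule ℝ (E n) := L₁.1 ⊓ M.1 ⊓ L₂.1 with hK
  have h1 : K ≤ L₁.1 := fun x hx => hx.1.1
  have h2 : K ≤ M.1 := fun x hx => hx.1.2
  have h3 : K ≤ L₂.1 := fun x hx => hx.2
  let f : K × K × K →ₗ[ℝ] L₁.1 × M.1 × L₂.1 :=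
    (Submodule.inclusion h1).prodMap ((Submodule.inclusion h2).prodMap (Submodule.inclusion h3))
  have hinj : Function.Injective f := by
    refine (injective_iff_map_eq_zero f).2 ?_
    rintro ⟨a, b, c⟩ h
    exact Prod.ext (Subtype.ext (congrArg (fun p => (p.1 : E n)) h))
      (Prod.ext (Subtype.ext (congrArg (fun p => (p.2.1 : E n)) h))
        (Subtype.ext (congrArg (fun p => (p.2.2 : E n)) h)))
  have hrange : LinearMap.range f ≤ (maslovForm L₁ M L₂).radical := by
    rintro _ ⟨⟨a, b, c⟩, rfl⟩
    have e1 : ∀ x ∈ K, ∀ y ∈ L₁.1, omega n x y = 0 := fun x hx y hy => L₁.2.2 x (h1 hx) y hy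
    have e2 : ∀ x ∈ K, ∀ y ∈ M.1, omega n x y = 0 := fun x hx y hy => M.2.2 x (h2 hx) y hy
    have e3 : ∀ x ∈ K, ∀ y ∈ L₂.1, omega n x y = 0 := fun x hx y hy => L₂.2.2 x (h3 hx) y hy
    have e1' : ∀ x ∈ K, ∀ y ∈ L₁.1, omega n y x = 0 := fun x hx y hy => L₁.2.2 y hy x (h1 hx)
    have e2' : ∀ x ∈ K, ∀ y ∈ M.1, omega n y x = 0 := fun x hx y hy => M.2.2 y hy x (h2 hx)
    have e3' : ∀ x ∈ K, ∀ y ∈ L₂.1, omega n y x = 0 := fun x hx y hy => L₂.2.2 y hy x (h3 hx)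
    have e0 : ∀ x ∈ K, ∀ y ∈ K, omega n x y = 0 := fun x hx y hy => e1 x hx y (h1 hy)
    rw [QuadraticMap.mem_radical_iff']
    refine ⟨?_, ?_⟩
    · simp [maslovForm_apply, f, e0]
    · rintro ⟨v, w, x⟩
      simp [maslovForm_apply, f, e0, e1, e1', e2, e2', e3, e3']
  calc _ = Module.finrank ℝ (K × K × K) := by
        rw [Module.finrank_prod, Module.finrank_prod]; ring
    _ = Module.finrank ℝ (LinearMap.range f) := (LinearMap.finrank_range_of_inj hinj).symm
    _ ≤ _ := Submodule.finrank_mono hrange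

/-- An element of `L₁` that lies in the radical of the form lies in all three Lagrangians. -/
theorem finrank_inl_inf_radical_le (L₁ M L₂ : Lag n) :
    Module.finrank ℝ (LinearMap.range (LinearMap.inl ℝ L₁.1 (M.1 × L₂.1)) ⊓
        (maslovForm L₁ M L₂).radical : Submodule ℝ (L₁.1 × M.1 × L₂.1)) ≤
      Module.finrank ℝ (L₁.1 ⊓ M.1 ⊓ L₂.1 : Submodule ℝ (E n)) := by
  have h1 : L₁.1 ⊓ M.1 ⊓ L₂.1 ≤ L₁.1 := fun x hx => hx.1.1
  let f : (L₁.1 ⊓ M.1 ⊓ L₂.1 : Submodule ℝ (E n)) →ₗ[ℝ] L₁.1 × M.1 × L₂.1 :=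
    LinearMap.inl ℝ L₁.1 (M.1 × L₂.1) ∘ₗ Submodule.inclusion h1
  refine (Submodule.finrank_mono ?_).trans (LinearMap.finrank_range_le f)
  rintro _ ⟨⟨v, rfl⟩, hv⟩
  rw [SetLike.mem_coe, QuadraticMap.mem_radical_iff'] at hv
  refine ⟨⟨v.1, ⟨v.2, M.mem_of_omega_eq_zero fun w hw => ?_⟩,
    L₂.mem_of_omega_eq_zero fun x hx => ?_⟩, rfl⟩
  · have := hv.2 (0, ⟨w, hw⟩, 0)
    rw [omega_swap]
    simpa [maslovForm_apply] using this
  · have := hv.2 (0, 0, ⟨x, hx⟩)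
    simpa [maslovForm_apply] using this

/-- Let `ρ` be the dimension of the radical. Index `n` in dimension `3n` forces `sigPos = 2n - ρ/2`.
The form is nonpositive on `L₁` plus the radical, so `ρ/2` is at most the dimension of the
intersection of these two. That intersection embeds in the triple intersection, whose dimension is
at most `ρ/3`. Hence `ρ = 0`. -/
theorem finrank_radical_eq_zero {L₁ M L₂ : Lag n} (h : maslovIndex L₁ M L₂ = n) :
    Module.finrank ℝ (maslovForm L₁ M L₂).radical = 0 := by
  set Q := maslovForm L₁ M L₂ with hQ
  set A := LinearMap.range (LinearMap.inl ℝ L₁.1 (M.1 × L₂.1)) with hA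
  have hdim := finrank_lag_prod L₁ M L₂
  have hsum := QuadraticForm.sigPos_add_sigNeg_add_radical (Q := Q)
  have hA' : Module.finrank ℝ A = n := by
    rw [hA, LinearMap.finrank_range_of_inj LinearMap.inl_injective, L₁.2.1]
  have hsup := Submodule.finrank_sup_add_finrank_inf_eq A Q.radical
  have hW : ∀ x ∈ A ⊔ Q.radical, Q x ≤ 0 := by
    intro x hx
    obtain ⟨_, ⟨v, rfl⟩, r, hr, rfl⟩ := Submodule.mem_sup.1 hx
    rw [add_comm, (QuadraticMap.mem_radical_iff'.1 hr).2, hQ, maslovForm_apply]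
    simp
  have hle := QuadraticForm.sigPos_add_finrank_le_of_nonpos hW
  have h1 := three_mul_finrank_inf_le L₁ M L₂
  have h2 := finrank_inl_inf_radical_le L₁ M L₂
  rw [← hQ] at h1 h2
  rw [← hA] at h2
  rw [maslovIndex, ← hQ] at h
  omega

/-- A triple of Lagrangians with maximal Maslov index is positive. -/
theorem posTriple_of_maslovIndex {L₁ M L₂ : Lag n} (h : maslovIndex L₁ M L₂ = n) :
    PosTriple L₁ M L₂ := by
  have hrad := finrank_radical_eq_zero h
  set Q := maslovForm L₁ M L₂ with hQ
  have hdim := finrank_lag_prod L₁ M L₂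
  have hsum := QuadraticForm.sigPos_add_sigNeg_add_radical (Q := Q)
  refine ⟨?_, fun v hv x hx hw hne => ?_⟩
  · rw [Submodule.eq_bot_iff]
    rintro a ⟨ha₁, ha₂⟩
    -- A vector common to `L₁` and `L₂` would produce a nonzero radical vector `(a, 0, a)`.
    have hmem : ((⟨a, ha₁⟩, 0, ⟨a, ha₂⟩) : L₁.1 × M.1 × L₂.1) ∈ Q.radical := by
      rw [QuadraticMap.mem_radical_iff']
      refine ⟨by simp [hQ, maslovForm_apply, omega_self], ?_⟩
      rintro ⟨v, w, x⟩
      have h1 := L₁.2.2 a ha₁ v v.2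
      have h2 := L₂.2.2 x x.2 a ha₂
      have h3 := omega_swap a (w : E n)
      simp [hQ, maslovForm_apply, omega_self, h1, h2, h3]
      ring
    rw [Submodule.finrank_eq_zero.1 hrad, Submodule.mem_bot, Prod.mk_eq_zero] at hmem
    exact congrArg Subtype.val hmem.1
  · by_contra! hle
    -- If `ω(v, x) ≤ 0`, the isotropic summand `L₁` together with `(v, v + x, x)` spans a
    -- nonpositive subspace of dimension `n + 1`. This contradicts `sigPos = 2n`.
    let f : L₁.1 × ℝ →ₗ[ℝ] L₁.1 × M.1 × L₂.1 :=
      LinearMap.inl ℝ L₁.1 (M.1 × L₂.1) ∘ₗ LinearMap.fst ℝ L₁.1 ℝ +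
        LinearMap.toSpanSingleton ℝ (L₁.1 × M.1 × L₂.1) (⟨v, hv⟩, ⟨v + x, hw⟩, ⟨x, hx⟩) ∘ₗ
          LinearMap.snd ℝ L₁.1 ℝ
    have hf : Function.Injective f := by
      refine (injective_iff_map_eq_zero f).2 ?_
      rintro ⟨a, t⟩ hat
      simp only [f, LinearMap.add_apply, LinearMap.comp_apply, LinearMap.fst_apply,
        LinearMap.snd_apply, LinearMap.inl_apply, LinearMap.toSpanSingleton_apply, Prod.smul_mk,
        Prod.mk_add_mk, Prod.mk_eq_zero, zero_add] at hat
      have ht : t = 0 := by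
        have := congrArg Subtype.val hat.2.1
        exact (smul_eq_zero.1 this).resolve_right hne
      subst ht
      simpa using hat.1
    have hW := sigPos_add_finrank_le_of_linearMap Q f hf <| by
      rintro ⟨a, t⟩
      have h1 := L₁.2.2 a a.2 v hv
      have h2 := omega_swap (a : E n) x
      have h3 := omega_swap v x
      have : Q (f (a, t)) = t ^ 2 * omega n v x := by
        simp [f, hQ, maslovForm_apply, h1, h2, h3, omega_self]
        ring
      rw [this]
      exact mul_nonpos_of_nonneg_of_nonpos (sq_nonneg t) hle
    rw [Module.finrank_prod, L₁.2.1, Module.finrank_self] at hW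
    rw [maslovIndex, ← hQ] at h
    omega

end Maslov

/-! ### Blocks of symplectic matrices -/

section Blocks

variable {n : ℕ}

theorem mulVec_elim (g : Matrix (Fin n ⊕ Fin n) (Fin n ⊕ Fin n) ℝ) (x y : Fin n → ℝ) :
    g.mulVec (Sum.elim x y) = Sum.elim (g.toBlocks₁₁.mulVec x + g.toBlocks₁₂.mulVec y)
      (g.toBlocks₂₁.mulVec x + g.toBlocks₂₂.mulVec y) := by
  conv_lhs => rw [← Matrix.fromBlocks_toBlocks g]
  rw [Matrix.fromBlocks_mulVec]
  rfl

theorem omega_elim (x y z w : Fin n → ℝ) :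
    omega n (Sum.elim x y) (Sum.elim z w) = x ⬝ᵥ w - y ⬝ᵥ z := by
  rw [omega_apply]
  rfl

theorem elim_mem_spanE (x : Fin n → ℝ) : (Sum.elim x 0 : E n) ∈ (spanE n).1 :=
  mem_spanE.2 fun _ => rfl

theorem elim_mem_spanF (x : Fin n → ℝ) : (Sum.elim 0 x : E n) ∈ (spanF n).1 :=
  mem_spanF.2 fun _ => rfl

theorem exists_elim_of_mem_spanE {x : E n} (hx : x ∈ (spanE n).1) :
    ∃ z : Fin n → ℝ, (Sum.elim z 0 : E n) = x :=
  ⟨x ∘ Sum.inl, by ext (i | i) <;> simp [mem_spanE.1 hx]⟩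

theorem exists_elim_of_mem_spanF {x : E n} (hx : x ∈ (spanF n).1) :
    ∃ z : Fin n → ℝ, (Sum.elim 0 z : E n) = x :=
  ⟨x ∘ Sum.inr, by ext (i | i) <;> simp [mem_spanF.1 hx]⟩

/-- The Lagrangian `Span(e₁ + f₁, …, eₙ + fₙ)`. -/
def spanD (n : ℕ) : Lag n := triMatrix (1 : On n) • spanE n

theorem elim_mem_spanD (x : Fin n → ℝ) : (Sum.elim x x : E n) ∈ (spanD n).1 :=
  ⟨Sum.elim x 0, elim_mem_spanE x, by simp [mulVec_elim, triMatrix]⟩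

theorem exists_elim_of_mem_spanD {x : E n} (hx : x ∈ (spanD n).1) :
    ∃ z : Fin n → ℝ, (Sum.elim z z : E n) = x := by
  obtain ⟨y, hy, rfl⟩ := hx
  obtain ⟨z, rfl⟩ := exists_elim_of_mem_spanE hy
  exact ⟨z, by simp [mulVec_elim, triMatrix]⟩

theorem Lag.smul_eq_of_forall {g : Sp n} {L M : Lag n} (h : ∀ x ∈ L.1, g.1.mulVec x ∈ M.1) :
    g • L = M :=
  Lag.eq_of_le (by rintro _ ⟨x, hx, rfl⟩; exact h x hx)

theorem Lag.mulVec_mem {g : Sp n} {L M : Lag n} (h : g • L = M) {x : E n} (hx : x ∈ L.1) :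
    g.1.mulVec x ∈ M.1 :=
  h ▸ ⟨x, hx, rfl⟩

theorem triMatrix_smul_spanE (u : On n) : triMatrix u • spanE n = spanD n := by
  refine Lag.smul_eq_of_forall fun x hx => ?_
  obtain ⟨z, rfl⟩ := exists_elim_of_mem_spanE hx
  simpa [mulVec_elim, triMatrix] using elim_mem_spanD (u.1.mulVec z)

theorem matrix_eq_zero_of_mulVec {A : Matrix (Fin n) (Fin n) ℝ} (h : ∀ z, A.mulVec z = 0) :
    A = 0 :=
  Matrix.ext_of_mulVec_single fun i => by rw [h, Matrix.zero_mulVec]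

theorem toBlocks₁₁_eq_zero {g : Sp n} (h : g • spanE n = spanF n) : g.1.toBlocks₁₁ = 0 := by
  refine matrix_eq_zero_of_mulVec fun z => funext fun i => ?_
  simpa [mulVec_elim] using mem_spanF.1 (Lag.mulVec_mem h (elim_mem_spanE z)) i

theorem toBlocks₁₂_eq_zero {g : Sp n} (h : g • spanF n = spanF n) : g.1.toBlocks₁₂ = 0 := by
  refine matrix_eq_zero_of_mulVec fun z => funext fun i => ?_
  simpa [mulVec_elim] using mem_spanF.1 (Lag.mulVec_mem h (elim_mem_spanF z)) i

theorem toBlocks₂₁_eq_zero {g : Sp n} (h : g • spanE n = spanE n) : g.1.toBlocks₂₁ = 0 := by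
  refine matrix_eq_zero_of_mulVec fun z => funext fun i => ?_
  simpa [mulVec_elim] using mem_spanE.1 (Lag.mulVec_mem h (elim_mem_spanE z)) i

theorem toBlocks₂₂_eq_zero {g : Sp n} (h : g • spanF n = spanE n) : g.1.toBlocks₂₂ = 0 := by
  refine matrix_eq_zero_of_mulVec fun z => funext fun i => ?_
  simpa [mulVec_elim] using mem_spanE.1 (Lag.mulVec_mem h (elim_mem_spanF z)) i

theorem toBlocks₂₁_eq_toBlocks₁₁ {g : Sp n} (h : g • spanE n = spanD n) :
    g.1.toBlocks₂₁ = g.1.toBlocks₁₁ := by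
  refine sub_eq_zero.1 (matrix_eq_zero_of_mulVec fun z => ?_)
  obtain ⟨w, hw⟩ := exists_elim_of_mem_spanD (Lag.mulVec_mem h (elim_mem_spanE z))
  rw [mulVec_elim, Sum.elim_eq_iff] at hw
  rw [Matrix.sub_mulVec, sub_eq_zero]
  simpa using hw.2.symm.trans hw.1

theorem toBlocks₁₂_eq_neg_toBlocks₁₁ {g : Sp n} (h : g • spanD n = spanF n) :
    g.1.toBlocks₁₂ = -g.1.toBlocks₁₁ := by
  refine eq_neg_iff_add_eq_zero.2 (matrix_eq_zero_of_mulVec fun z => ?_)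
  have := mem_spanF.1 (Lag.mulVec_mem h (elim_mem_spanD z))
  ext i
  simpa [mulVec_elim, Matrix.add_mulVec, add_comm] using this i

theorem blocks_symplectic (g : Sp n) :
    g.1.toBlocks₁₁.transpose * g.1.toBlocks₂₂ - g.1.toBlocks₂₁.transpose * g.1.toBlocks₁₂ = 1 := by
  have h := SymplecticGroup.mem_iff'.1 g.2
  rw [← Matrix.fromBlocks_toBlocks g.1, Matrix.J, Matrix.fromBlocks_transpose,
    Matrix.fromBlocks_multiply, Matrix.fromBlocks_multiply, Matrix.fromBlocks_inj] at h
  have h2 := h.2.1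
  simp only [Matrix.mul_zero, Matrix.mul_one, Matrix.mul_neg,
    zero_add, add_zero, Matrix.neg_mul] at h2
  rw [← neg_inj, ← h2]
  abel

end Blocks

/-! ### The Maslov index of the standard triple -/

section StandardTriple

variable {n : ℕ}

/-- The embedding of `ℝⁿ` as `Span(e)`. -/
def toSpanE (n : ℕ) : (Fin n → ℝ) →ₗ[ℝ] (spanE n).1 where
  toFun x := ⟨Sum.elim x 0, elim_mem_spanE x⟩
  map_add' x y := Subtype.ext (by ext (i | i) <;> simp)
  map_smul' r x := Subtype.ext (by ext (i | i) <;> simp)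

/-- The embedding of `ℝⁿ` as `Span(f)`. -/
def toSpanF (n : ℕ) : (Fin n → ℝ) →ₗ[ℝ] (spanF n).1 where
  toFun x := ⟨Sum.elim 0 x, elim_mem_spanF x⟩
  map_add' x y := Subtype.ext (by ext (i | i) <;> simp)
  map_smul' r x := Subtype.ext (by ext (i | i) <;> simp)

/-- The embedding of `ℝⁿ` as `Span(e + f)`. -/
def toSpanD (n : ℕ) : (Fin n → ℝ) →ₗ[ℝ] (spanD n).1 where
  toFun x := ⟨Sum.elim x x, elim_mem_spanD x⟩
  map_add' x y := Subtype.ext (by ext (i | i) <;> simp)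
  map_smul' r x := Subtype.ext (by ext (i | i) <;> simp)

theorem maslovForm_standard (a y c : Fin n → ℝ) :
    maslovForm (spanE n) (spanD n) (spanF n) (toSpanE n a, toSpanD n y, toSpanF n c) =
      a ⬝ᵥ y + y ⬝ᵥ c - a ⬝ᵥ c := by
  simp only [maslovForm_apply, toSpanE, toSpanD, toSpanF, LinearMap.coe_mk, AddHom.coe_mk,
    omega_elim]
  simp [dotProduct_comm c a]
  ring

/-- In coordinates the form is `a·y + y·c - a·c`. The substitution `a = y + z`, `c = y - z` turns it
into `y·y + z·z`, positive on `2n` dimensions, and on `(z, 0, z)` it is `-z·z`, negative on `n`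
more. These exhaust the dimension `3n`. -/
theorem maslovIndex_standard (n : ℕ) : maslovIndex (spanE n) (spanD n) (spanF n) = n := by
  set Q := maslovForm (spanE n) (spanD n) (spanF n) with hQ
  let pr₁ := LinearMap.fst ℝ (Fin n → ℝ) (Fin n → ℝ)
  let pr₂ := LinearMap.snd ℝ (Fin n → ℝ) (Fin n → ℝ)
  have hpos := le_sigPos_of_linearMap Q
    ((toSpanE n ∘ₗ (pr₁ + pr₂)).prod ((toSpanD n ∘ₗ pr₁).prod (toSpanF n ∘ₗ (pr₁ - pr₂)))) <| by
      rintro ⟨y, z⟩ hne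
      have : Q (toSpanE n (y + z), toSpanD n y, toSpanF n (y - z)) = y ⬝ᵥ y + z ⬝ᵥ z := by
        rw [hQ, maslovForm_standard]
        simp only [add_dotProduct, dotProduct_sub]
        ring
      refine lt_of_lt_of_eq ?_ this.symm
      have hy := dotProduct_self_star_nonneg y
      have hz := dotProduct_self_star_nonneg z
      simp only [star_trivial] at hy hz
      refine lt_of_le_of_ne (add_nonneg hy hz) fun h0 => hne ?_
      rw [Prod.mk_eq_zero, ← dotProduct_self_eq_zero, ← dotProduct_self_eq_zero (v := z)]
      constructor <;> linarith
  have hneg := le_sigPos_of_linearMap (-Q)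
    ((toSpanE n).prod ((0 : (Fin n → ℝ) →ₗ[ℝ] (spanD n).1).prod (toSpanF n))) <| by
      intro z hne
      have : (-Q) (toSpanE n z, toSpanD n 0, toSpanF n z) = z ⬝ᵥ z := by
        rw [neg_apply, hQ, maslovForm_standard]
        simp
      rw [map_zero] at this
      refine lt_of_lt_of_eq ?_ this.symm
      have hz := dotProduct_self_star_nonneg z
      rw [star_trivial] at hz
      exact lt_of_le_of_ne hz fun h0 => hne (dotProduct_self_eq_zero.1 h0.symm)
  have hsum := QuadraticForm.sigPos_add_sigNeg_add_radical (Q := Q)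
  rw [finrank_lag_prod] at hsum
  rw [sigPos_neg] at hneg
  simp only [Module.finrank_prod, Module.finrank_fin_fun] at hpos hneg
  rw [maslovIndex, ← hQ]
  omega

end StandardTriple

/-! ### The normal form of a positive triple -/

section NormalForm

variable {n : ℕ}

/-- The matrix whose columns form a symplectic basis. -/
theorem exists_sp_of_basis {e f : Fin n → E n} (hee : ∀ i j, omega n (e i) (e j) = 0)
    (hff : ∀ i j, omega n (f i) (f j) = 0)
    (hef : ∀ i j, omega n (e i) (f j) = (1 : Matrix (Fin n) (Fin n) ℝ) i j) :
    ∃ g : Sp n, ∀ x y : Fin n → ℝ,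
      g.1.mulVec (Sum.elim x y) = ∑ i, x i • e i + ∑ i, y i • f i := by
  let g : Matrix (Fin n ⊕ Fin n) (Fin n ⊕ Fin n) ℝ := (Matrix.of (Sum.elim e f)).transpose
  have hg : g ∈ Matrix.symplecticGroup (Fin n) ℝ := by
    rw [SymplecticGroup.mem_iff']
    have key : ∀ p q, (g.transpose * Matrix.J (Fin n) ℝ * g) p q =
        -omega n (Sum.elim e f p) (Sum.elim e f q) := by
      intro p q
      rw [omega_eq, neg_neg, Matrix.mul_assoc, Matrix.mul_apply']
      congr 1
    ext (i | i) (j | j)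
    · rw [key]; simp [hee, Matrix.J]
    · rw [key]; simp [hef, Matrix.J]
    · rw [key, omega_swap]; simp [hef, Matrix.J, Matrix.one_apply, eq_comm]
    · rw [key]; simp [hff, Matrix.J]
  refine ⟨⟨g, hg⟩, fun x y => ?_⟩
  ext p
  simp [Matrix.mulVec, dotProduct, g, mul_comm]

/-- `M` is the graph of a map `b i ↦ c i` from a basis of `L₁` to `L₂`. The matrix `G` of the `ω(b
i, c j)` is symmetric because `M` is isotropic, and positive definite because the triple is
positive. Applying `G^(-1/2)` to both families gives a symplectic basis, and the use of the same
coefficients keeps the sums `e i + f i` in `M`. -/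
theorem PosTriple.exists_sp {L₁ M L₂ : Lag n} (h : PosTriple L₁ M L₂) :
    ∃ g : Sp n, g • spanE n = L₁ ∧ g • spanD n = M ∧ g • spanF n = L₂ := by
  let b := Module.finBasisOfFinrankEq ℝ L₁.1 L₁.2.1
  have hex : ∀ i, ∃ x ∈ L₂.1, (b i : E n) + x ∈ M.1 := by
    intro i
    obtain ⟨x, hx, m, hm, hsum⟩ := Submodule.mem_sup.1
      (h.rotate.rotate.isCompl.sup_eq_top.symm ▸ Submodule.mem_top : (b i : E n) ∈ L₂.1 ⊔ M.1)
    exact ⟨-x, neg_mem hx, by rw [← hsum]; simpa using hm⟩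
  choose c hc hbc using hex
  let G : Matrix (Fin n) (Fin n) ℝ := Matrix.of fun i j => omega n (b i) (c j)
  have hGsymm : G.transpose = G := by
    ext i j
    have h1 := M.2.2 _ (hbc i) _ (hbc j)
    simp only [map_add, LinearMap.add_apply, L₁.2.2 _ (b i).2 _ (b j).2,
      L₂.2.2 _ (hc i) _ (hc j), zero_add, add_zero] at h1
    have h2 := omega_swap (b j : E n) (c i)
    simp only [G, Matrix.transpose_apply, Matrix.of_apply]
    linarith
  have hsum : ∀ x y : Fin n → ℝ,
      omega n (∑ i, x i • (b i : E n)) (∑ i, y i • c i) = x ⬝ᵥ G.mulVec y := by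
    intro x y
    simp only [map_sum, LinearMap.sum_apply, map_smul, LinearMap.smul_apply, smul_eq_mul,
      dotProduct, Matrix.mulVec, G, Matrix.of_apply, Finset.mul_sum]
    rw [Finset.sum_comm]
    exact Finset.sum_congr rfl fun i _ => Finset.sum_congr rfl fun j _ => by ring
  have hG : G.PosDef := by
    refine Matrix.PosDef.of_dotProduct_mulVec_pos (by simpa [Matrix.IsHermitian] using hGsymm) ?_
    intro x hx
    rw [star_trivial, ← hsum]
    have hv : ∑ i, x i • (b i : E n) ∈ L₁.1 :=
      Submodule.sum_mem _ fun i _ => Submodule.smul_mem _ _ (b i).2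
    have hw : ∑ i, x i • c i ∈ L₂.1 :=
      Submodule.sum_mem _ fun i _ => Submodule.smul_mem _ _ (hc i)
    refine h.2 _ hv _ hw ?_ fun h0 => hx ?_
    · rw [← Finset.sum_add_distrib]
      exact Submodule.sum_mem _ fun i _ => by
        rw [← smul_add]; exact Submodule.smul_mem _ _ (hbc i)
    · have hz : ∑ i, x i • (b i : E n) ∈ L₁.1 ⊓ L₂.1 :=
        ⟨hv, by rw [eq_neg_of_add_eq_zero_left h0]; exact neg_mem hw⟩
      rw [h.1, Submodule.mem_bot] at hz
      have hz' : ∑ i, x i • b i = 0 := Subtype.ext (by simpa using hz)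
      exact funext (Fintype.linearIndependent_iff.1 b.linearIndependent x hz')
  let R := (CFC.sqrt G)⁻¹
  have hRG : R * G * R.transpose = 1 := by
    have hu := sqrt_isUnit_det hG
    rw [Matrix.transpose_nonsing_inv, sqrt_transpose]
    conv_lhs => enter [1, 2]; rw [← sqrt_mul_sqrt hG]
    rw [← Matrix.mul_assoc, Matrix.nonsing_inv_mul _ hu, Matrix.one_mul,
      Matrix.mul_nonsing_inv _ hu]
  have he : ∀ i, ∑ j, R i j • (b j : E n) ∈ L₁.1 := fun i =>
    Submodule.sum_mem _ fun j _ => Submodule.smul_mem _ _ (b j).2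
  have hf : ∀ i, ∑ j, R i j • c j ∈ L₂.1 := fun i =>
    Submodule.sum_mem _ fun j _ => Submodule.smul_mem _ _ (hc j)
  obtain ⟨g, hg⟩ := exists_sp_of_basis (fun i j => L₁.2.2 _ (he i) _ (he j))
    (fun i j => L₂.2.2 _ (hf i) _ (hf j)) (fun i j => by
      rw [hsum, ← hRG, Matrix.mul_assoc, Matrix.mul_apply']
      rfl)
  refine ⟨g, Lag.smul_eq_of_forall fun x hx => ?_, Lag.smul_eq_of_forall fun x hx => ?_,
    Lag.smul_eq_of_forall fun x hx => ?_⟩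
  · obtain ⟨z, rfl⟩ := exists_elim_of_mem_spanE hx
    rw [hg]
    simpa using Submodule.sum_mem _ fun i _ => Submodule.smul_mem _ (z i) (he i)
  · obtain ⟨z, rfl⟩ := exists_elim_of_mem_spanD hx
    rw [hg, ← Finset.sum_add_distrib]
    refine Submodule.sum_mem _ fun i _ => ?_
    rw [← smul_add, ← Finset.sum_add_distrib]
    refine Submodule.smul_mem _ _ (Submodule.sum_mem _ fun j _ => ?_)
    rw [← smul_add]
    exact Submodule.smul_mem _ _ (hbc j)
  · obtain ⟨z, rfl⟩ := exists_elim_of_mem_spanF hx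
    rw [hg]
    simpa using Submodule.sum_mem _ fun i _ => Submodule.smul_mem _ (z i) (hf i)

end NormalForm

open IdealTriangulation

variable {V : Type*}

/-! ### Maximality does not depend on the triangulation -/

theorem smul_lag_of_eq_neg_one {n : ℕ} {g : Sp n} (hg : g.1 = -1) (L : Lag n) : g • L = L := by
  refine Lag.smul_eq_of_forall fun x hx => ?_
  rw [hg, Matrix.neg_mulVec, Matrix.one_mulVec]
  exact neg_mem hx

namespace FramedLocalSystem

variable {T T' : IdealTriangulation V} {n : ℕ}

/-- The product around a face is `-1`, which acts trivially on Lagrangians, and the third arrow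
takes `Lb` to `Lt`. -/
theorem tri_smul_tri_smul_Lt (F : FramedLocalSystem T n) (u : V) :
    F.tri (T.next u) • F.tri u • F.Lt u = F.Lb (T.next (T.next u)) := by
  have h : (F.tri (T.next (T.next u)) * F.tri (T.next u) * F.tri u) • F.Lt u = F.Lt u :=
    smul_lag_of_eq_neg_one (F.tri_twisted u) _
  have h' := F.tri_Lb (T.next (T.next u))
  rw [T.next_next_next] at h'
  rw [← smul_left_cancel_iff (F.tri (T.next (T.next u))), h', ← mul_smul, ← mul_smul,
    h]

/-- Positivity of the triple of Lagrangians of a face, seen from the side `T.next u`. -/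
def PosAt (F : FramedLocalSystem T n) (u : V) : Prop :=
  PosTriple (F.Lt (T.next u)) (F.tri u • F.Lt u) (F.Lb (T.next u))

/-- Transport along the next arrow of the face permutes the three Lagrangians cyclically, which
`PosTriple.rotate` undoes. So one side per face is enough to check. -/
theorem PosAt.next {F : FramedLocalSystem T n} {u : V} (h : F.PosAt u) : F.PosAt (T.next u) := by
  have := (h.smul (F.tri (T.next u))).rotate.rotate
  rwa [tri_smul_tri_smul_Lt, F.tri_Lb] at this

theorem AllMaslovMaximal.posAt {F : FramedLocalSystem T n} (h : F.AllMaslovMaximal) (u : V) :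
    F.PosAt u :=
  posTriple_of_maslovIndex (h u)

/-- Parallel transport across an edge between two positive faces yields the positivity of a face
containing the other diagonal of the quadrilateral. -/
theorem posTriple_across_edge {F : FramedLocalSystem T n} (h : ∀ u, F.PosAt u) (a : T.A₂) {c : V}
    (hc : T.next c = src a) :
    PosTriple (F.Lt (T.next (tgt a))) ((F.tri (tgt a) * F.edge a * F.tri c) • F.Lt c)
      (F.Lb (T.next (tgt a))) := by
  have h1 : PosTriple (F.Lt (src a)) (F.tri c • F.Lt c) (F.Lb (src a)) := by
    have := h c
    rwa [PosAt, hc] at this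
  -- Crossing the edge exchanges the top and bottom Lagrangians. In the fibre at `T.next (tgt a)`
  -- the two triples then share the Lagrangians at the ends of the diagonal, as `exchange` requires.
  have h2 := h1.smul (F.tri (tgt a) * F.edge a)
  rw [mul_smul, F.edge_Lt, F.tri_Lb, mul_smul _ _ (F.Lb _), F.edge_Lb, ← mul_smul] at h2
  exact h2.exchange (h (tgt a))

/-- The corner relations express the arrows of `F` that cut across the new diagonal as products
through the edge in `F'`, so `posTriple_across_edge` in `F'` treats one side of each of the two
flipped faces. The other sides follow by `PosAt.next`, and the remaining faces are unchanged. -/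
theorem IsFlip.posAt {F : FramedLocalSystem T n} {F' : FramedLocalSystem T' n} {v : V}
    (hf : F.IsFlip F' v) (h : ∀ u, F'.PosAt u) (u : V) : F.PosAt u := by
  have hT := hf.flip
  set w := T.opp v with hw
  have hne3 : ∀ x, T.next (T.next x) ≠ x := fun x hx => by
    have h1 := T.next_next_next x
    rw [hx] at h1
    exact T.next_ne x h1
  have hvw : w ≠ v := hT.internal
  have hinj := T.next.injective
  have hoppv : T'.opp v = w := by rw [hT.opp_eq]
  have hoppw : T'.opp w = v := by rw [hT.opp_eq, hw, T.opp_opp]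
  have hva : w ≠ T.next v := hT.ne_next
  have hvb : w ≠ T.next (T.next v) := hT.ne_next_next
  have hwc : v ≠ T.next w := fun h' => hvb (by rw [h', T.next_next_next])
  have hwd : v ≠ T.next (T.next w) := fun h' => hva (by rw [h', T.next_next_next])
  have hA : F.PosAt (T.next v) := by
    have := posTriple_across_edge h (rev ⟨v, hf.flip.internal'⟩) (c := T.next v)
      (by simpa [rev, src, hoppv] using hT.next_a)
    simp only [tgt, rev, T'.opp_opp] at this
    have hca := hf.corner_a
    simp only [rev] at hca
    rw [← hca, hT.next_v, hf.Lt_eq _ (hne3 v) hvb.symm, hf.Lb_eq _ (hne3 v) hvb.symm,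
      hf.Lt_eq _ (T.next_ne v) hva.symm] at this
    exact this
  have hC : F.PosAt (T.next w) := by
    have := posTriple_across_edge h ⟨v, hf.flip.internal'⟩ (c := T.next w) hT.next_c
    simp only [tgt, hoppv] at this
    have hcc := hf.corner_c
    rw [← hw] at hcc
    rw [← hcc, hT.next_w, hf.Lt_eq _ hwd.symm (hne3 w), hf.Lb_eq _ hwd.symm (hne3 w),
      hf.Lt_eq _ hwc.symm (T.next_ne w)] at this
    exact this
  have hA' := hA.next.next
  have hC' := hC.next.next
  rw [T.next_next_next] at hA' hC'
  by_cases h1 : u = v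
  · exact h1 ▸ hA'
  by_cases h2 : u = T.next v
  · exact h2 ▸ hA
  by_cases h3 : u = T.next (T.next v)
  · exact h3 ▸ hA.next
  by_cases h4 : u = w
  · exact h4 ▸ hC'
  by_cases h5 : u = T.next w
  · exact h5 ▸ hC
  by_cases h6 : u = T.next (T.next w)
  · exact h6 ▸ hC.next
  have hnv : T.next u ≠ v := fun h' => h3 (by rw [← h', T.next_next_next])
  have hnw : T.next u ≠ w := fun h' => h6 (by rw [← h', T.next_next_next])
  have := h u
  rwa [PosAt, hT.next_other u h1 h2 h3 h4 h5 h6, hf.tri_eq u h1 h2 h3 h4 h5 h6,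
    hf.Lt_eq _ hnv hnw, hf.Lb_eq _ hnv hnw, hf.Lt_eq _ h1 h4] at this

/-- Induction goes backwards along the flips, starting from the triangulation where all indices are
maximal. -/
theorem IsMaximal.posAt {F : FramedLocalSystem T n} (h : F.IsMaximal) (u : V) : F.PosAt u := by
  obtain ⟨p, hp, hmax⟩ := h
  have key : ∀ q : Σ T : IdealTriangulation V, FramedLocalSystem T n,
      Relation.ReflTransGen (FlipStep n) q p → ∀ u, q.2.PosAt u := by
    intro q hq
    induction hq using Relation.ReflTransGen.head_induction_on with
    | refl => exact hmax.posAt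
    | head hstep _ ih =>
      obtain ⟨v, hv⟩ := hstep
      exact hv.posAt ih
  exact key _ hp u

end FramedLocalSystem

theorem holSystem_isMaximal (T : IdealTriangulation V) {n : ℕ} (x : XPlus T n) :
    (holSystem T x).IsMaximal := by
  refine ⟨⟨T, holSystem T x⟩, Relation.ReflTransGen.refl, fun v => ?_⟩
  change maslovIndex (spanE n) (triMatrix _ • spanE n) (spanF n) = n
  rw [triMatrix_smul_spanE, maslovIndex_standard]

/-! ### Orthogonal matrices and singular values -/

section Orthogonal

variable {n : ℕ}

theorem On.mul_transpose (r : On n) : r.1 * r.1.transpose = 1 :=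
  (Matrix.mem_orthogonalGroup_iff (Fin n) ℝ).1 r.2

theorem On.transpose_mul (r : On n) : r.1.transpose * r.1 = 1 :=
  (Matrix.mem_orthogonalGroup_iff' (Fin n) ℝ).1 r.2

theorem On.coe_inv (r : On n) : (r⁻¹ : On n).1 = r.1.transpose := by
  change star r.1 = _
  rw [Matrix.star_eq_conjTranspose, Matrix.conjTranspose_eq_transpose_of_trivial]

/-- The block diagonal embedding `r ↦ diag(r, r)` of `O(n)` in `Sp(2n, ℝ)`. -/
def orthSp (n : ℕ) : On n →* Sp n where
  toFun r := ⟨Matrix.fromBlocks r.1 0 0 r.1, by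
    rw [SymplecticGroup.mem_iff, Matrix.J, Matrix.fromBlocks_transpose,
      Matrix.fromBlocks_multiply, Matrix.fromBlocks_multiply]
    simp [r.mul_transpose]⟩
  map_one' := Subtype.ext (by simp)
  map_mul' r s := Subtype.ext (by simp [Matrix.fromBlocks_multiply])

theorem orthSp_coe (r : On n) : (orthSp n r).1 = Matrix.fromBlocks r.1 0 0 r.1 := rfl

theorem orthSp_smul_spanE (r : On n) : orthSp n r • spanE n = spanE n := by
  refine Lag.smul_eq_of_forall fun x hx => ?_
  obtain ⟨z, rfl⟩ := exists_elim_of_mem_spanE hx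
  simpa [mulVec_elim, orthSp_coe] using elim_mem_spanE (r.1.mulVec z)

theorem orthSp_smul_spanF (r : On n) : orthSp n r • spanF n = spanF n := by
  refine Lag.smul_eq_of_forall fun x hx => ?_
  obtain ⟨z, rfl⟩ := exists_elim_of_mem_spanF hx
  simpa [mulVec_elim, orthSp_coe] using elim_mem_spanF (r.1.mulVec z)

theorem triMatrix_mul_orthSp (u r : On n) : triMatrix u * orthSp n r = triMatrix (u * r) :=
  Subtype.ext (by simp [triMatrix, orthSp_coe, Matrix.fromBlocks_multiply])

theorem orthSp_mul_triMatrix (u r : On n) : orthSp n r * triMatrix u = triMatrix (r * u) :=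
  Subtype.ext (by simp [triMatrix, orthSp_coe, Matrix.fromBlocks_multiply])

theorem triMatrix_injective : Function.Injective (triMatrix (n := n)) := fun _ _ h =>
  Subtype.ext (Matrix.fromBlocks_inj.1 (congrArg Subtype.val h)).1

theorem triMatrix_mul_mul_toBlocks₁₁ (u₁ u₂ u₃ : On n) :
    ((triMatrix u₃).1 * (triMatrix u₂).1 * (triMatrix u₁).1).toBlocks₁₁ = -(u₃ * u₂ * u₁).1 := by
  simp [triMatrix, Matrix.fromBlocks_multiply]

/-- A symplectic matrix that permutes `Span(e)`, `Span(e + f)`, `Span(f)` cyclically. -/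
theorem exists_eq_triMatrix {g : Sp n} (hE : g • spanE n = spanD n) (hD : g • spanD n = spanF n)
    (hF : g • spanF n = spanE n) : ∃ u, g = triMatrix u := by
  have h1 := toBlocks₂₁_eq_toBlocks₁₁ hE
  have h2 := toBlocks₁₂_eq_neg_toBlocks₁₁ hD
  have h3 := toBlocks₂₂_eq_zero hF
  have h4 := blocks_symplectic g
  rw [h1, h2, h3, Matrix.mul_zero, Matrix.mul_neg, zero_sub, neg_neg] at h4
  refine ⟨⟨g.1.toBlocks₁₁, (Matrix.mem_orthogonalGroup_iff' _ _).2 h4⟩, Subtype.ext ?_⟩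
  conv_lhs => rw [← Matrix.fromBlocks_toBlocks g.1, h1, h2, h3]
  rfl

/-- Diagonalization of a positive definite matrix, with nondecreasing eigenvalues. -/
theorem exists_orthogonal_diagonalization {P : Matrix (Fin n) (Fin n) ℝ} (hP : P.PosDef) :
    ∃ (r : On n) (d : Fin n → ℝ), (∀ i, 0 < d i) ∧ Monotone d ∧
      r.1 * P * r.1.transpose = Matrix.diagonal d := by
  let ev := hP.isHermitian.eigenvalues
  let U : Matrix (Fin n) (Fin n) ℝ := hP.isHermitian.eigenvectorUnitary.1
  have hU : star U * U = 1 := Unitary.coe_star_mul_self hP.isHermitian.eigenvectorUnitary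
  have hUP : star U * P * U = Matrix.diagonal ev := by
    have := hP.isHermitian.conjStarAlgAut_star_eigenvectorUnitary
    rw [Unitary.conjStarAlgAut_star_apply] at this
    exact this
  -- The rows of the diagonalizing matrix are permuted so that the eigenvalues become nondecreasing.
  let σ := Tuple.sort ev
  have ht : ((star U).submatrix σ id).transpose = U.submatrix id σ := by
    ext i j
    simp
  have hs : ∀ A : Matrix (Fin n) (Fin n) ℝ,
      (star U).submatrix σ id * A * U.submatrix id σ = (star U * A * U).submatrix σ σ := by
    intro A
    rw [Matrix.submatrix_mul (star U * A) U σ id σ Function.bijective_id,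
      Matrix.submatrix_mul (star U) A σ id id Function.bijective_id, Matrix.submatrix_id_id]
  refine ⟨⟨(star U).submatrix σ id, (Matrix.mem_orthogonalGroup_iff _ _).2 ?_⟩, ev ∘ σ,
    fun i => hP.eigenvalues_pos _, Tuple.monotone_sort ev, ?_⟩
  · have := hs 1
    rw [Matrix.mul_one, Matrix.mul_one, hU, Matrix.submatrix_one_equiv] at this
    rw [ht, this]
  · change (star U).submatrix σ id * P * ((star U).submatrix σ id).transpose = _
    rw [ht, hs, hUP, Matrix.submatrix_diagonal_equiv]

/-- The singular value decomposition of an invertible matrix, with nondecreasing singular values. -/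
theorem exists_singular_value_decomposition {C : Matrix (Fin n) (Fin n) ℝ} (hC : IsUnit C.det) :
    ∃ (s r : On n) (d : Fin n → ℝ), (∀ i, 0 < d i) ∧ Monotone d ∧
      s.1 * C * r.1.transpose = Matrix.diagonal d := by
  have hP : (C.transpose * C).PosDef := by
    have := Matrix.PosDef.conjTranspose_mul_self C
      (Matrix.mulVec_injective_of_isUnit ((Matrix.isUnit_iff_isUnit_det C).2 hC))
    rwa [Matrix.conjTranspose_eq_transpose_of_trivial] at this
  obtain ⟨r, d, hd, hmono, hr⟩ := exists_orthogonal_diagonalization hP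
  let e : Fin n → ℝ := fun i => √(d i)
  have he : ∀ i, 0 < e i := fun i => Real.sqrt_pos.2 (hd i)
  -- The requirement `s C rᵀ = e` forces `s = e r C⁻¹`. Since `r CᵀC = e² r`, this equals `e⁻¹ r
  -- Cᵀ`.
  let s : Matrix (Fin n) (Fin n) ℝ := Matrix.diagonal (fun i => (e i)⁻¹) * r.1 * C.transpose
  have hsC : s * C * r.1.transpose = Matrix.diagonal e := by
    calc s * C * r.1.transpose
        = Matrix.diagonal (fun i => (e i)⁻¹) * (r.1 * (C.transpose * C) * r.1.transpose) := by
          simp only [s, Matrix.mul_assoc]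
      _ = Matrix.diagonal e := by
          rw [hr, Matrix.diagonal_mul_diagonal]
          congr 1
          ext i
          rw [← Real.mul_self_sqrt (hd i).le, ← mul_assoc]
          exact (congrArg (· * e i) (inv_mul_cancel₀ (he i).ne')).trans (one_mul _)
  have hs : s * s.transpose = 1 := by
    calc s * s.transpose = (s * C * r.1.transpose) * Matrix.diagonal (fun i => (e i)⁻¹) := by
          simp only [s, Matrix.transpose_mul, Matrix.transpose_transpose,
            Matrix.diagonal_transpose, Matrix.mul_assoc]
      _ = 1 := by
          rw [hsC, Matrix.diagonal_mul_diagonal, ← Matrix.diagonal_one]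
          congr 1
          ext i
          exact mul_inv_cancel₀ (he i).ne'
  exact ⟨⟨s, (Matrix.mem_orthogonalGroup_iff _ _).2 hs⟩, r, e, he,
    fun i j hij => Real.sqrt_le_sqrt (hmono hij), hsC⟩

end Orthogonal

/-! ### Edge matrices -/

section EdgeMatrix

variable {n : ℕ}

theorem sqrt_diagonal {d : Fin n → ℝ} (hd : ∀ i, 0 ≤ d i) :
    CFC.sqrt (Matrix.diagonal d) = Matrix.diagonal fun i => √(d i) := by
  refine CFC.sqrt_unique ?_ ?_
  · rw [Matrix.diagonal_mul_diagonal]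
    congr 1
    ext i
    exact Real.mul_self_sqrt (hd i)
  · exact Matrix.nonneg_iff_posSemidef.2
      (Matrix.posSemidef_diagonal_iff.2 fun i => Real.sqrt_nonneg _)

theorem inv_diagonal {d : Fin n → ℝ} (hd : ∀ i, 0 < d i) :
    (Matrix.diagonal d)⁻¹ = Matrix.diagonal fun i => (d i)⁻¹ := by
  refine Matrix.inv_eq_right_inv ?_
  rw [Matrix.diagonal_mul_diagonal, ← Matrix.diagonal_one]
  congr 1
  ext i
  exact mul_inv_cancel₀ (hd i).ne'

/-- On diagonal matrices the square root is explicit, which reduces continuity and intertwining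
questions to individual entries. -/
theorem edgeMatrix_of_mem_delta {S : Matrix (Fin n) (Fin n) ℝ} (hS : S.PosDef)
    (hD : S ∈ Delta n) :
    (edgeMatrix S hS).1 = Matrix.fromBlocks 0 (-Matrix.diagonal fun i => (√(S i i))⁻¹)
      (Matrix.diagonal fun i => √(S i i)) 0 := by
  obtain ⟨d, hd, -, rfl⟩ := hD
  simp only [edgeMatrix, sqrt_diagonal fun i => (hd i).le,
    inv_diagonal fun i => Real.sqrt_pos.2 (hd i), Matrix.diagonal_apply_eq]

/-- A symplectic matrix exchanging `Span(e)` and `Span(f)` is an edge matrix as soon as its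
lower left block is diagonal with positive nondecreasing entries. -/
theorem eq_edgeMatrix {g : Sp n} (hE : g • spanE n = spanF n) (hF : g • spanF n = spanE n)
    {d : Fin n → ℝ} (hd : ∀ i, 0 < d i) (hg : g.1.toBlocks₂₁ = Matrix.diagonal d)
    (hS : (Matrix.diagonal d * Matrix.diagonal d).PosDef) :
    g = edgeMatrix (Matrix.diagonal d * Matrix.diagonal d) hS := by
  have h1 := toBlocks₁₁_eq_zero hE
  have h2 := toBlocks₂₂_eq_zero hF
  have h3 := blocks_symplectic g
  rw [h2, Matrix.mul_zero, zero_sub, hg, Matrix.diagonal_transpose, ← Matrix.mul_neg] at h3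
  have hsq : CFC.sqrt (Matrix.diagonal d * Matrix.diagonal d) = Matrix.diagonal d :=
    CFC.sqrt_unique rfl (Matrix.nonneg_iff_posSemidef.2
      (Matrix.posSemidef_diagonal_iff.2 fun i => (hd i).le))
  refine Subtype.ext ?_
  conv_lhs => rw [← Matrix.fromBlocks_toBlocks g.1, h1, h2, hg]
  simp only [edgeMatrix, hsq, Matrix.inv_eq_right_inv h3, neg_neg]

end EdgeMatrix

/-! ### The gauge action -/

theorem conj_eq_neg_one {n : ℕ} {g : Sp n} (hg : g.1 = -1) (k : Sp n) :
    (k * g * k⁻¹).1 = -1 := by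
  have hk : k.1 * (k⁻¹ : Sp n).1 = 1 := congrArg Subtype.val (mul_inv_cancel k)
  change k.1 * g.1 * (k⁻¹ : Sp n).1 = -1
  rw [hg, mul_neg, neg_mul, mul_one, hk]

theorem IdealTriangulation.tgt_rev {T : IdealTriangulation V} (a : T.A₂) : tgt (rev a) = src a :=
  T.opp_opp a.1

theorem IdealTriangulation.src_rev {T : IdealTriangulation V} (a : T.A₂) : src (rev a) = tgt a :=
  rfl

theorem IdealTriangulation.rev_rev {T : IdealTriangulation V} (a : T.A₂) : rev (rev a) = a :=
  Subtype.ext (T.opp_opp a.1)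

namespace FramedLocalSystem

variable {T : IdealTriangulation V} {n : ℕ}

/-- Change of trivialization of the fibres. -/
def gauge (ψ : V → Sp n) (F : FramedLocalSystem T n) : FramedLocalSystem T n where
  edge a := ψ (tgt a) * F.edge a * (ψ (src a))⁻¹
  tri v := ψ (T.next v) * F.tri v * (ψ v)⁻¹
  Lt v := ψ v • F.Lt v
  Lb v := ψ v • F.Lb v
  edge_twisted a := by
    have h := conj_eq_neg_one (g := F.edge (rev a) * F.edge a) (F.edge_twisted a) (ψ (src a))
    rw [← h, tgt_rev, src_rev]
    exact congrArg Subtype.val (by group : ψ (src a) * F.edge (rev a) * (ψ (tgt a))⁻¹ *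
      (ψ (tgt a) * F.edge a * (ψ (src a))⁻¹) =
        ψ (src a) * (F.edge (rev a) * F.edge a) * (ψ (src a))⁻¹)
  tri_twisted v := by
    have h := conj_eq_neg_one (g := F.tri (T.next (T.next v)) * F.tri (T.next v) * F.tri v)
      (F.tri_twisted v) (ψ v)
    rw [← h, T.next_next_next]
    exact congrArg Subtype.val (by group : ψ v * F.tri (T.next (T.next v)) *
      (ψ (T.next (T.next v)))⁻¹ * (ψ (T.next (T.next v)) * F.tri (T.next v) * (ψ (T.next v))⁻¹) *
      (ψ (T.next v) * F.tri v * (ψ v)⁻¹) =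
        ψ v * (F.tri (T.next (T.next v)) * F.tri (T.next v) * F.tri v) * (ψ v)⁻¹)
  edge_Lt a := by rw [mul_smul, inv_smul_smul, mul_smul, F.edge_Lt]
  edge_Lb a := by rw [mul_smul, inv_smul_smul, mul_smul, F.edge_Lb]
  tri_Lb v := by rw [mul_smul, inv_smul_smul, mul_smul, F.tri_Lb]

theorem gauge_edge (ψ : V → Sp n) (F : FramedLocalSystem T n) (a : T.A₂) :
    (gauge ψ F).edge a = ψ (tgt a) * F.edge a * (ψ (src a))⁻¹ := rfl

theorem gauge_tri (ψ : V → Sp n) (F : FramedLocalSystem T n) (v : V) :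
    (gauge ψ F).tri v = ψ (T.next v) * F.tri v * (ψ v)⁻¹ := rfl

theorem gauge_Lt (ψ : V → Sp n) (F : FramedLocalSystem T n) (v : V) :
    (gauge ψ F).Lt v = ψ v • F.Lt v := rfl

theorem gauge_Lb (ψ : V → Sp n) (F : FramedLocalSystem T n) (v : V) :
    (gauge ψ F).Lb v = ψ v • F.Lb v := rfl

theorem equivalent_iff {F F' : FramedLocalSystem T n} :
    F.Equivalent F' ↔ ∃ ψ, gauge ψ F = F' := by
  constructor
  · rintro ⟨ψ, h1, h2, h3, h4⟩
    refine ⟨ψ, FramedLocalSystem.ext ?_ ?_ ?_ ?_⟩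
    · exact funext fun a => mul_inv_eq_of_eq_mul (h1 a).symm
    · exact funext fun v => mul_inv_eq_of_eq_mul (h2 v).symm
    · exact funext h3
    · exact funext h4
  · rintro ⟨ψ, rfl⟩
    exact ⟨ψ, fun a => inv_mul_cancel_right _ _, fun v => inv_mul_cancel_right _ _,
      fun v => rfl, fun v => rfl⟩

theorem mk_gauge (ψ : V → Sp n) (F : FramedLocalSystem T n) :
    (⟦gauge ψ F⟧ : Moduli T n) = ⟦F⟧ :=
  (Quotient.sound (equivalent_iff.2 ⟨ψ, rfl⟩)).symm

/-- The framing is the standard one in every fibre. -/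
structure IsStandard (F : FramedLocalSystem T n) : Prop where
  Lt_eq : ∀ v, F.Lt v = spanE n
  Lb_eq : ∀ v, F.Lb v = spanF n

theorem IsStandard.edge_smul_spanE {F : FramedLocalSystem T n} (h : F.IsStandard) (a : T.A₂) :
    F.edge a • spanE n = spanF n := by
  simpa [h.Lt_eq, h.Lb_eq] using F.edge_Lt a

theorem IsStandard.edge_smul_spanF {F : FramedLocalSystem T n} (h : F.IsStandard) (a : T.A₂) :
    F.edge a • spanF n = spanE n := by
  simpa [h.Lt_eq, h.Lb_eq] using F.edge_Lb a

/-- With off-diagonal blocks `B` and `C` for `a`, symplecticity says `Cᵀ(-B) = 1` and the twisting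
says `C'(-B) = 1` for the block `C'` of the reverse arrow. Thus one decomposition diagonalizes both
arrows of a 2-cycle. -/
theorem IsStandard.toBlocks₂₁_rev {F : FramedLocalSystem T n} (h : F.IsStandard) (a : T.A₂) :
    (F.edge (rev a)).1.toBlocks₂₁ = (F.edge a).1.toBlocks₂₁.transpose := by
  have h1 := blocks_symplectic (F.edge a)
  rw [toBlocks₁₁_eq_zero (h.edge_smul_spanE a), Matrix.transpose_zero, Matrix.zero_mul, zero_sub,
    ← Matrix.mul_neg] at h1
  have h2 := congrArg Matrix.toBlocks₂₂ (F.edge_twisted a)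
  rw [← Matrix.fromBlocks_toBlocks (F.edge (rev a)).1, ← Matrix.fromBlocks_toBlocks (F.edge a).1,
    Matrix.fromBlocks_multiply, Matrix.toBlocks_fromBlocks₂₂,
    toBlocks₂₂_eq_zero (h.edge_smul_spanF a), Matrix.mul_zero, add_zero,
    ← Matrix.fromBlocks_one, Matrix.fromBlocks_neg, Matrix.toBlocks_fromBlocks₂₂] at h2
  have h3 : (F.edge (rev a)).1.toBlocks₂₁ * -(F.edge a).1.toBlocks₁₂ = 1 := by
    rw [Matrix.mul_neg, h2, neg_neg]
  rw [← Matrix.inv_eq_left_inv h3, Matrix.inv_eq_left_inv h1]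

theorem IsStandard.isUnit_det {F : FramedLocalSystem T n} (h : F.IsStandard) (a : T.A₂) :
    IsUnit (F.edge a).1.toBlocks₂₁.det := by
  have h1 := blocks_symplectic (F.edge a)
  rw [toBlocks₁₁_eq_zero (h.edge_smul_spanE a), Matrix.transpose_zero, Matrix.zero_mul, zero_sub,
    ← Matrix.mul_neg] at h1
  rw [← Matrix.det_transpose]
  exact Matrix.isUnit_det_of_right_inverse h1

/-- A maximal system can be trivialized so that the triple of each face is the standard one. -/
theorem exists_gauge_isStandard (F : FramedLocalSystem T n) (hF : ∀ u, F.PosAt u) :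
    ∃ (ψ : V → Sp n) (u : V → On n), (gauge ψ F).IsStandard ∧
      ∀ v, (gauge ψ F).tri v = triMatrix (u v) := by
  have hex : ∀ v, ∃ g : Sp n, g • spanE n = F.Lt v ∧
      g • spanD n = F.tri (T.next (T.next v)) • F.Lt (T.next (T.next v)) ∧
      g • spanF n = F.Lb v := by
    intro v
    have := (hF (T.next (T.next v))).exists_sp
    rwa [T.next_next_next] at this
  choose h hE hD hF using hex
  -- In the adapted bases, the arrow permutes the three standard Lagrangians cyclically.
  have htri : ∀ v, ∃ u, (h (T.next v))⁻¹ * F.tri v * h v = triMatrix u := by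
    intro v
    refine exists_eq_triMatrix ?_ ?_ ?_
    · rw [mul_smul, mul_smul, hE, inv_smul_eq_iff, hD, T.next_next_next]
    · rw [mul_smul, mul_smul, hD, inv_smul_eq_iff, hF]
      have := F.tri_smul_tri_smul_Lt (T.next (T.next v))
      rwa [T.next_next_next] at this
    · rw [mul_smul, mul_smul, hF, F.tri_Lb, inv_smul_eq_iff, hE]
  choose u hu using htri
  refine ⟨fun v => (h v)⁻¹, u, ⟨fun v => ?_, fun v => ?_⟩, fun v => ?_⟩
  · rw [gauge_Lt, inv_smul_eq_iff, hE]
  · rw [gauge_Lb, inv_smul_eq_iff, hF]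
  · rw [gauge_tri, inv_inv, hu]

/-- Simultaneous singular value decompositions along all internal edges. -/
theorem exists_orthogonal_edge_diagonal [Finite V] (C : T.A₂ → Matrix (Fin n) (Fin n) ℝ)
    (hC : ∀ a, IsUnit (C a).det) (hrev : ∀ a, C (rev a) = (C a).transpose) :
    ∃ r : V → On n, ∀ a, ∃ d : Fin n → ℝ, (∀ i, 0 < d i) ∧ Monotone d ∧
      (r (tgt a)).1 * C a * (r (src a)).1.transpose = Matrix.diagonal d := by
  classical
  choose s r d hd hmono hsr using fun a => exists_singular_value_decomposition (hC a)
  let idx := Finite.equivFin V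
  -- Each side meets at most one internal edge, so the choices for different edges do not interact.
  -- The numbering `idx` orients each edge: its smaller side takes the right factor, its larger side
  -- the left factor of the same decomposition, and external sides take `1`.
  let ρ : V → On n := fun v => if h : T.opp v = v then 1 else
    if idx v < idx (T.opp v) then r ⟨v, h⟩ else s (rev ⟨v, h⟩)
  have hlt : ∀ a : T.A₂, idx (src a) < idx (tgt a) →
      (ρ (tgt a)).1 * C a * (ρ (src a)).1.transpose = Matrix.diagonal (d a) := by
    intro a ha
    have h1 : ρ (src a) = r a := (dif_neg a.2).trans (if_pos ha)
    have h2 : ρ (tgt a) = s a := by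
      have hn : ¬ idx (tgt a) < idx (T.opp (tgt a)) := by
        rw [show T.opp (tgt a) = src a from T.opp_opp a.1]
        exact ha.le.not_gt
      refine (dif_neg (rev a).2).trans ((if_neg hn).trans ?_)
      exact congrArg s (rev_rev a)
    rw [h1, h2, hsr]
  refine ⟨ρ, fun a => ?_⟩
  rcases lt_or_gt_of_ne (fun h => a.2 (idx.injective h).symm : idx (src a) ≠ idx (tgt a))
    with h | h
  · exact ⟨d a, hd a, hmono a, hlt a h⟩
  · refine ⟨d (rev a), hd _, hmono _, ?_⟩
    have := congrArg Matrix.transpose (hlt (rev a) (by rwa [tgt_rev, src_rev]))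
    rw [Matrix.diagonal_transpose, tgt_rev, src_rev, hrev] at this
    rw [← this]
    simp only [Matrix.transpose_mul, Matrix.transpose_transpose, Matrix.mul_assoc]

/-- Two successive gauges: the first standardizes the faces, the second, by matrices `diag(r, r)`,
keeps that shape and diagonalizes the edge blocks. The edge coordinate is the square of the singular
values because `edgeMatrix` contains a square root. -/
theorem exists_holSystem_equivalent [Finite V] (F : FramedLocalSystem T n)
    (hF : ∀ u, F.PosAt u) : ∃ x : XPlusDelta T n, holDelta T n x = ⟦F⟧ := by
  obtain ⟨ψ, u, hstd, htri⟩ := F.exists_gauge_isStandard hF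
  set F₁ := gauge ψ F with hF₁
  obtain ⟨r, hr⟩ := exists_orthogonal_edge_diagonal (fun a => (F₁.edge a).1.toBlocks₂₁)
    hstd.isUnit_det hstd.toBlocks₂₁_rev
  choose d hd hmono hr using hr
  set F₂ := gauge (fun v => orthSp n (r v)) F₁ with hF₂
  have hstd₂ : F₂.IsStandard := ⟨fun v => by
      rw [hF₂, gauge_Lt, hstd.Lt_eq]; exact orthSp_smul_spanE _, fun v => by
      rw [hF₂, gauge_Lb, hstd.Lb_eq]; exact orthSp_smul_spanF _⟩
  have htri₂ : ∀ v, F₂.tri v = triMatrix (r (T.next v) * u v * (r v)⁻¹) := by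
    intro v
    rw [hF₂, gauge_tri, htri, ← map_inv, orthSp_mul_triMatrix, triMatrix_mul_orthSp]
  have hedge₂ : ∀ a, (F₂.edge a).1.toBlocks₂₁ = Matrix.diagonal (d a) := by
    intro a
    rw [← hr a, hF₂]
    change ((orthSp n (r (tgt a))).1 * (F₁.edge a).1 *
      ((orthSp n (r (src a)))⁻¹ : Sp n).1).toBlocks₂₁ = _
    rw [← map_inv, orthSp_coe, orthSp_coe, On.coe_inv]
    conv_lhs => rw [← Matrix.fromBlocks_toBlocks (F₁.edge a).1]
    simp [Matrix.fromBlocks_multiply]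
  have hpd : ∀ a, (Matrix.diagonal (d a) * Matrix.diagonal (d a)).PosDef := by
    intro a
    rw [Matrix.diagonal_mul_diagonal, Matrix.posDef_diagonal_iff]
    exact fun i => mul_pos (hd a i) (hd a i)
  let x : XPlusDelta T n := ⟨⟨(fun a => Matrix.diagonal (d a) * Matrix.diagonal (d a),
      fun v => r (T.next v) * u v * (r v)⁻¹), hpd, fun a => ?_, fun v => ?_⟩, fun a => ?_⟩
  · refine ⟨x, ?_⟩
    rw [← mk_gauge ψ F, ← hF₁, ← mk_gauge (fun v => orthSp n (r v)) F₁, ← hF₂]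
    refine congrArg _ (FramedLocalSystem.ext ?_ ?_ ?_ ?_)
    · exact funext fun a => (eq_edgeMatrix (hstd₂.edge_smul_spanE a) (hstd₂.edge_smul_spanF a)
        (hd a) (hedge₂ a) (hpd a)).symm
    · exact funext fun v => (htri₂ v).symm
    · exact funext fun v => (hstd₂.Lt_eq v).symm
    · exact funext fun v => (hstd₂.Lb_eq v).symm
  · have : Matrix.diagonal (d (rev a)) = Matrix.diagonal (d a) := by
      rw [← hedge₂, hstd₂.toBlocks₂₁_rev, hedge₂, Matrix.diagonal_transpose]
    change Matrix.diagonal (d (rev a)) * Matrix.diagonal (d (rev a)) = _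
    rw [this]
  · have := congrArg Matrix.toBlocks₁₁ (F₂.tri_twisted v)
    rw [htri₂, htri₂, htri₂, triMatrix_mul_mul_toBlocks₁₁, ← Matrix.fromBlocks_one,
      Matrix.fromBlocks_neg, Matrix.toBlocks_fromBlocks₁₁, neg_inj] at this
    exact Subtype.ext this
  · refine ⟨fun i => d a i * d a i, fun i => mul_pos (hd a i) (hd a i), fun i j hij => ?_,
      Matrix.diagonal_mul_diagonal _ _⟩
    exact mul_self_le_mul_self (hd a i).le (hmono a hij)

end FramedLocalSystem

/-! ### Fibres of the holonomy map -/

section Fibres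

variable {n : ℕ}

/-- A change of symplectic bases that fixes `Span(e)` and `Span(f)` and is compatible with the
transition matrix of an arrow in a face is orthogonal. -/
theorem exists_eq_orthSp {g h : Sp n} {u u' : On n} (hgE : g • spanE n = spanE n)
    (hgF : g • spanF n = spanF n) (hhF : h • spanF n = spanF n)
    (hgh : triMatrix u' * g = h * triMatrix u) : ∃ r, g = orthSp n r := by
  have h1 := toBlocks₁₂_eq_zero hgF
  have h2 := toBlocks₂₁_eq_zero hgE
  have h3 := toBlocks₁₂_eq_zero hhF
  have h4 := congrArg Subtype.val hgh
  change (triMatrix u').1 * g.1 = h.1 * (triMatrix u).1 at h4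
  rw [← Matrix.fromBlocks_toBlocks g.1, ← Matrix.fromBlocks_toBlocks h.1, h1, h2, h3] at h4
  simp only [triMatrix, Matrix.fromBlocks_multiply, Matrix.fromBlocks_inj] at h4
  obtain ⟨h5, h6, -, -⟩ := h4
  simp only [Matrix.mul_zero, Matrix.zero_mul, add_zero, zero_add, Matrix.neg_mul, Matrix.mul_neg,
    neg_inj] at h5 h6
  -- Multiplied by `u'`, both diagonal blocks of `g` give the upper left block of `h` times `u`.
  -- Their equality turns the symplectic relation into orthogonality.
  have h7 : g.1.toBlocks₂₂ = g.1.toBlocks₁₁ := by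
    have := congrArg (u'.1.transpose * ·) (h6.trans h5.symm)
    simpa only [← Matrix.mul_assoc, u'.transpose_mul, Matrix.one_mul] using this
  have h8 := blocks_symplectic g
  rw [h1, h7, Matrix.mul_zero, sub_zero] at h8
  refine ⟨⟨g.1.toBlocks₁₁, (Matrix.mem_orthogonalGroup_iff' _ _).2 h8⟩, Subtype.ext ?_⟩
  rw [orthSp_coe]
  conv_lhs => rw [← Matrix.fromBlocks_toBlocks g.1, h1, h2, h7]

theorem edgeMatrix_mul_orthSp_iff {S S' : Matrix (Fin n) (Fin n) ℝ} {hS : S.PosDef}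
    {hS' : S'.PosDef} (hD : S ∈ Delta n) (hD' : S' ∈ Delta n) {r r' : On n} :
    edgeMatrix S' hS' * orthSp n r = orthSp n r' * edgeMatrix S hS ↔
      ∀ i j, √(S' i i) * r.1 i j = r'.1 i j * √(S j j) ∧
        (√(S' i i))⁻¹ * r.1 i j = r'.1 i j * (√(S j j))⁻¹ := by
  rw [Subtype.ext_iff]
  change (edgeMatrix S' hS').1 * (orthSp n r).1 = (orthSp n r').1 * (edgeMatrix S hS).1 ↔ _
  rw [edgeMatrix_of_mem_delta hS hD, edgeMatrix_of_mem_delta hS' hD', orthSp_coe, orthSp_coe,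
    Matrix.fromBlocks_multiply, Matrix.fromBlocks_multiply, Matrix.fromBlocks_inj]
  simp only [Matrix.mul_zero, Matrix.zero_mul, add_zero, zero_add, Matrix.neg_mul, Matrix.mul_neg,
    neg_inj, neg_zero, true_and, and_true]
  simp only [← Matrix.ext_iff, Matrix.diagonal_mul, Matrix.mul_diagonal]
  exact ⟨fun h i j => ⟨h.2 i j, h.1 i j⟩, fun h => ⟨fun i j => (h i j).2, fun i j => (h i j).1⟩⟩

/-- Sorted diagonal matrices that are conjugate by an invertible matrix are equal. -/
theorem eq_of_monotone_of_intertwine {d d' : Fin n → ℝ} (hd : Monotone d) (hd' : Monotone d')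
    {r : Matrix (Fin n) (Fin n) ℝ} (hr : r.det ≠ 0) (h : ∀ i j, r i j ≠ 0 → d' i = d j) :
    d = d' := by
  -- Some term of the Leibniz expansion of the determinant is nonzero. Its permutation matches the
  -- two lists, and two nondecreasing rearrangements of one list coincide.
  obtain ⟨σ, hσ⟩ : ∃ σ : Equiv.Perm (Fin n), ∏ i, r (σ i) i ≠ 0 := by
    by_contra! h0
    exact hr (by rw [Matrix.det_apply]; exact Finset.sum_eq_zero fun σ _ => by rw [h0, smul_zero])
  have hdσ : d' ∘ σ = d := funext fun i =>
    h _ _ fun h0 => hσ (Finset.prod_eq_zero (Finset.mem_univ i) h0)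
  have := Tuple.unique_monotone (f := d') (σ := σ) (τ := 1) (hdσ ▸ hd) hd'
  rw [← hdσ, this]
  rfl

theorem diag_pos_of_mem_delta {S : Matrix (Fin n) (Fin n) ℝ} (hS : S ∈ Delta n) (i : Fin n) :
    0 < S i i := by
  obtain ⟨d, hd, -, rfl⟩ := hS
  simpa using hd i

theorem diag_monotone_of_mem_delta {S : Matrix (Fin n) (Fin n) ℝ} (hS : S ∈ Delta n) :
    Monotone fun i => S i i := by
  obtain ⟨d, -, hd, rfl⟩ := hS
  simpa using hd

theorem eq_diagonal_of_mem_delta {S : Matrix (Fin n) (Fin n) ℝ} (hS : S ∈ Delta n) :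
    S = Matrix.diagonal fun i => S i i := by
  obtain ⟨d, -, -, rfl⟩ := hS
  simp

theorem commute_iff_of_mem_delta {S : Matrix (Fin n) (Fin n) ℝ} (hS : S ∈ Delta n)
    (r : Matrix (Fin n) (Fin n) ℝ) :
    Commute r S ↔ ∀ i j, r i j ≠ 0 → S i i = S j j := by
  rw [Commute, SemiconjBy, ← Matrix.ext_iff]
  refine forall_congr' fun i => forall_congr' fun j => ?_
  rw [eq_diagonal_of_mem_delta hS]
  simp only [Matrix.diagonal_mul, Matrix.mul_diagonal, Matrix.diagonal_apply_eq]
  rw [mul_comm, mul_eq_mul_right_iff, or_iff_not_imp_right, eq_comm (a := S j j)]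

theorem On.det_ne_zero (r : On n) : r.1.det ≠ 0 :=
  (Matrix.isUnit_det_of_right_inverse r.mul_transpose).ne_zero

/-- Orthogonal matrices intertwining two diagonal edge matrices. -/
theorem edgeMatrix_intertwine_iff {S S' : Matrix (Fin n) (Fin n) ℝ} {hS : S.PosDef}
    {hS' : S'.PosDef} (hD : S ∈ Delta n) (hD' : S' ∈ Delta n) {r r' : On n} :
    edgeMatrix S' hS' * orthSp n r = orthSp n r' * edgeMatrix S hS ↔
      S = S' ∧ r = r' ∧ Commute r.1 S := by
  rw [edgeMatrix_mul_orthSp_iff hD hD', commute_iff_of_mem_delta hD]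
  have hs := fun i => Real.sqrt_pos.2 (diag_pos_of_mem_delta hD i)
  have hs' := fun i => Real.sqrt_pos.2 (diag_pos_of_mem_delta hD' i)
  constructor
  · intro h
    -- The two off-diagonal blocks give two relations between `r` and `r'`. Eliminating `r'` leaves
    -- `S' i i * r i j = S j j * r i j`.
    have hsq : ∀ i j, r.1 i j ≠ 0 → S' i i = S j j := by
      intro i j hij
      obtain ⟨h1, h2⟩ := h i j
      have h3 : r.1 i j * √(S j j) = √(S' i i) * r'.1 i j := by
        have := (hs j).ne'
        have := (hs' i).ne'
        field_simp at h2
        linarith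
      have h4 : √(S' i i) * √(S' i i) * r.1 i j = √(S j j) * √(S j j) * r.1 i j := by
        rw [mul_assoc, h1, ← mul_assoc, ← h3]
        ring
      have := mul_right_cancel₀ hij h4
      rwa [Real.mul_self_sqrt (diag_pos_of_mem_delta hD' i).le,
        Real.mul_self_sqrt (diag_pos_of_mem_delta hD j).le] at this
    have hSS : (fun i => S i i) = fun i => S' i i :=
      eq_of_monotone_of_intertwine (diag_monotone_of_mem_delta hD)
        (diag_monotone_of_mem_delta hD') r.det_ne_zero hsq
    have hSS' : S = S' := by
      rw [eq_diagonal_of_mem_delta hD, eq_diagonal_of_mem_delta hD', hSS]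
    subst hSS'
    refine ⟨rfl, Subtype.ext ?_, hsq⟩
    ext i j
    have h1 := (h i j).1
    by_cases hij : r.1 i j = 0
    · rw [hij, mul_zero, eq_comm, mul_eq_zero] at h1
      rw [hij, h1.resolve_right (hs j).ne']
    · rw [hsq i j hij, mul_comm] at h1
      exact mul_right_cancel₀ (hs j).ne' h1
  · rintro ⟨rfl, rfl, h⟩ i j
    by_cases hij : r.1 i j = 0
    · simp [hij]
    · rw [h i j hij]
      exact ⟨mul_comm _ _, mul_comm _ _⟩

/-- An equivalence preserves the framings and intertwines the face arrows, so it is orthogonal at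
each side by `exists_eq_orthSp`. The edge arrows are then governed by `edgeMatrix_intertwine_iff`.
-/
theorem holDelta_eq_iff {T : IdealTriangulation V} (x x' : XPlusDelta T n) :
    holDelta T n x = holDelta T n x' ↔
      (∀ a : T.A₂, x.1.1.1 a = x'.1.1.1 a) ∧
      ∃ r : V → On n,
        (∀ a : T.A₂, r (src a) = r (tgt a) ∧
          Commute (r (src a) : Matrix (Fin n) (Fin n) ℝ) (x.1.1.1 a)) ∧
        ∀ v : V, x'.1.1.2 v = r (T.next v) * x.1.1.2 v * (r v)⁻¹ := by
  rw [holDelta, holDelta, hol, hol, Quotient.eq]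
  constructor
  · rintro ⟨ψ, h1, h2, h3, h4⟩
    have hex : ∀ v, ∃ r, ψ v = orthSp n r := fun v =>
      exists_eq_orthSp (h3 v) (h4 v) (h4 (T.next v)) (h2 v)
    choose r hr using hex
    have hedge := fun a => (edgeMatrix_intertwine_iff (hS := x.1.2.1 a) (hS' := x'.1.2.1 a)
      (x.2 a) (x'.2 a)).1 (hr (src a) ▸ hr (tgt a) ▸ h1 a)
    refine ⟨fun a => (hedge a).1, r, fun a => (hedge a).2, fun v => ?_⟩
    have := h2 v
    rw [hr, hr] at this
    rw [eq_mul_inv_iff_mul_eq]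
    refine triMatrix_injective ?_
    rw [← triMatrix_mul_orthSp, ← orthSp_mul_triMatrix]
    exact this
  · rintro ⟨h1, r, h2, h3⟩
    refine ⟨fun v => orthSp n (r v), fun a => ?_, fun v => ?_, fun v => orthSp_smul_spanE _,
      fun v => orthSp_smul_spanF _⟩
    · exact (edgeMatrix_intertwine_iff (hS := x.1.2.1 a) (hS' := x'.1.2.1 a)
        (x.2 a) (x'.2 a)).2 ⟨h1 a, h2 a⟩
    · change triMatrix _ * _ = _ * triMatrix _
      rw [h3, triMatrix_mul_orthSp, orthSp_mul_triMatrix, inv_mul_cancel_right]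

end Fibres

open Filter Topology

/-! ### Topology of the Lagrangian Grassmannian -/

section Grassmannian

variable {n : ℕ}

instance : IsTopologicalGroup (Sp n) where
  continuous_inv := by
    refine continuous_induced_rng.2 ?_
    change Continuous fun g : Sp n => -Matrix.J (Fin n) ℝ * g.1.transpose * Matrix.J (Fin n) ℝ
    fun_prop

theorem continuous_smul_spanE : Continuous fun g : Sp n => g • spanE n :=
  continuous_coinduced_rng

instance : ContinuousConstSMul (Sp n) (Lag n) where
  continuous_const_smul k := by
    refine continuous_coinduced_dom.2 ?_
    have : ((fun L : Lag n => k • L) ∘ fun g : Sp n => g • spanE n) = fun g => (k * g) • spanE n :=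
      funext fun g => (mul_smul k g _).symm
    rw [this]
    exact continuous_smul_spanE.comp (continuous_const_mul k)

/-- The saturation of an open set is a union of its right translates by elements of the stabilizer.
-/
theorem isOpenMap_smul_spanE : IsOpenMap fun g : Sp n => g • spanE n := by
  intro U hU
  refine isOpen_coinduced.2 ?_
  have : (fun g : Sp n => g • spanE n) ⁻¹' ((fun g : Sp n => g • spanE n) '' U) =
      ⋃ s ∈ {s : Sp n | s • spanE n = spanE n}, (fun g => g * s) ⁻¹' U := by
    ext g
    simp only [Set.mem_preimage, Set.mem_image, Set.mem_iUnion, Set.mem_ofPred_eq, exists_prop]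
    constructor
    · rintro ⟨h, hh, hgh⟩
      exact ⟨g⁻¹ * h, by rw [mul_smul, hgh, inv_smul_smul], by rwa [mul_inv_cancel_left]⟩
    · rintro ⟨s, hs, hgs⟩
      exact ⟨g * s, hgs, by rw [mul_smul, hs]⟩
  rw [this]
  exact isOpen_biUnion fun s _ => hU.preimage (continuous_mul_const s)

/-- Joint continuity of the action, at the base point of the Grassmannian. -/
theorem tendsto_smul_lag {ι : Type*} {l : Filter ι} {g : ι → Sp n} {L : ι → Lag n} {g₀ : Sp n}
    (hg : Tendsto g l (𝓝 g₀)) (hL : Tendsto L l (𝓝 (spanE n))) :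
    Tendsto (fun i => g i • L i) l (𝓝 (g₀ • spanE n)) := by
  rw [tendsto_nhds]
  intro U hU hmem
  have hc : Continuous fun p : Sp n × Sp n => (p.1 * p.2) • spanE n :=
    continuous_smul_spanE.comp continuous_mul
  have hnhds : (fun p : Sp n × Sp n => (p.1 * p.2) • spanE n) ⁻¹' U ∈ 𝓝 (g₀, 1) :=
    hc.continuousAt.preimage_mem_nhds (hU.mem_nhds (by simpa using hmem))
  obtain ⟨A, hA, B, hB, hAB⟩ := mem_nhds_prod_iff.1 hnhds
  -- Openness of the orbit map lifts Lagrangians close to `spanE n` to group elements close to `1`.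
  have hB' := isOpenMap_smul_spanE.image_mem_nhds hB
  rw [one_smul] at hB'
  filter_upwards [hg hA, hL hB'] with i hi hi'
  obtain ⟨h, hh, hLi⟩ := hi'
  have : (g i, h) ∈ (fun p : Sp n × Sp n => (p.1 * p.2) • spanE n) ⁻¹' U := hAB ⟨hi, hh⟩
  simp only [Set.mem_preimage, mul_smul] at this
  change g i • L i ∈ U
  rwa [← hLi]

/-- Uniqueness of limits in the orbit of the base point of the Grassmannian. -/
theorem smul_spanE_eq_of_tendsto {ι : Type*} {l : Filter ι} [NeBot l] {g : ι → Sp n} {g₀ : Sp n}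
    (hg : Tendsto g l (𝓝 g₀)) (hL : Tendsto (fun i => g i • spanE n) l (𝓝 (spanE n))) :
    g₀ • spanE n = spanE n := by
  -- The stabilizer is closed, being cut out by the vanishing of the lower left block. Hence pairs
  -- with distinct images of `spanE n` form an open set, which plays the role of a Hausdorff
  -- property.
  have hclosed : IsClosed {s : Sp n | ∀ i j, s.1 (Sum.inr i) (Sum.inl j) = 0} := by
    simp only [Set.ofPred_forall]
    refine isClosed_iInter fun i => isClosed_iInter fun j => isClosed_eq ?_ continuous_const
    exact (continuous_id.matrix_elem _ _).comp continuous_subtype_val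
  have hiff : ∀ s : Sp n, (∀ i j, s.1 (Sum.inr i) (Sum.inl j) = 0) ↔ s • spanE n = spanE n := by
    refine fun s => ⟨fun h => ?_, fun h i j => congrFun (congrFun (toBlocks₂₁_eq_zero h) i) j⟩
    have h0 : s.1.toBlocks₂₁ = 0 := by ext i j; exact h i j
    refine Lag.smul_eq_of_forall fun x hx => ?_
    obtain ⟨z, rfl⟩ := exists_elim_of_mem_spanE hx
    simpa [mulVec_elim, h0] using elim_mem_spanE (s.1.toBlocks₁₁.mulVec z)
  by_contra hne
  have hopen : IsOpen {p : Sp n × Sp n | (p.2⁻¹ * p.1) • spanE n ≠ spanE n} := by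
    have : {p : Sp n × Sp n | (p.2⁻¹ * p.1) • spanE n ≠ spanE n} =
        (fun p : Sp n × Sp n => p.2⁻¹ * p.1) ⁻¹'
          {s : Sp n | ∀ i j, s.1 (Sum.inr i) (Sum.inl j) = 0}ᶜ := by
      ext p
      simp only [Set.mem_ofPred_eq, Set.mem_preimage, Set.mem_compl_iff, hiff]
    rw [this]
    exact hclosed.isOpen_compl.preimage (by fun_prop)
  obtain ⟨A, hA, B, hB, hAB⟩ := mem_nhds_prod_iff.1
    (hopen.mem_nhds (by simpa using hne : (g₀, (1 : Sp n)) ∈ _))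
  have hB' := isOpenMap_smul_spanE.image_mem_nhds hB
  rw [one_smul] at hB'
  obtain ⟨i, hi, h, hh, hgh⟩ := ((hg.eventually hA).and (hL.eventually hB')).exists
  have : (g i, h) ∈ {p : Sp n × Sp n | (p.2⁻¹ * p.1) • spanE n ≠ spanE n} := hAB ⟨hi, hh⟩
  exact this (by rw [mul_smul, ← hgh, inv_smul_smul])

/-- The symplectic matrix exchanging `Span(e)` and `Span(f)`. -/
def swapSp (n : ℕ) : Sp n := edgeMatrix 1 Matrix.PosDef.one

theorem swapSp_smul_spanE : swapSp n • spanE n = spanF n := smul_spanE_of_block rfl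

theorem swapSp_smul_spanF : swapSp n • spanF n = spanE n := smul_spanF_of_block rfl

theorem swapSp_mulVec (x y : Fin n → ℝ) :
    (swapSp n).1.mulVec (Sum.elim x y) = Sum.elim (-y) x := by
  have h : CFC.sqrt (1 : Matrix (Fin n) (Fin n) ℝ) = 1 := by
    simp
  simp [swapSp, edgeMatrix, mulVec_elim, h, Matrix.neg_mulVec]

theorem smul_spanF_eq_of_tendsto {ι : Type*} {l : Filter ι} [NeBot l] {g : ι → Sp n} {g₀ : Sp n}
    (hg : Tendsto g l (𝓝 g₀)) (hL : Tendsto (fun i => g i • spanF n) l (𝓝 (spanF n))) :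
    g₀ • spanF n = spanF n := by
  have h1 : Tendsto (fun i => swapSp n * g i * swapSp n) l (𝓝 (swapSp n * g₀ * swapSp n)) :=
    (hg.const_mul _).mul_const _
  have h2 := smul_spanE_eq_of_tendsto h1 (by
    have := hL.const_smul (swapSp n)
    simpa only [mul_smul, swapSp_smul_spanE, swapSp_smul_spanF] using this)
  rw [mul_smul, mul_smul, swapSp_smul_spanE, ← swapSp_smul_spanF] at h2
  exact smul_left_cancel _ h2

/-! ### Properness of the action on positive triples -/

/-- A neighbourhood of `Span(e)` consisting of graphs of maps with small norm. -/
theorem setOf_dotProduct_le_mem_nhds {δ : ℝ} (hδ : 0 < δ) :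
    {L : Lag n | ∀ x y : Fin n → ℝ, (Sum.elim x y : E n) ∈ L.1 → y ⬝ᵥ y ≤ δ * (x ⬝ᵥ x)} ∈
      𝓝 (spanE n) := by
  let a : Sp n → (Fin n → ℝ) → (Fin n → ℝ) := fun g z => g.1.toBlocks₁₁.mulVec z
  let c : Sp n → (Fin n → ℝ) → (Fin n → ℝ) := fun g z => g.1.toBlocks₂₁.mulVec z
  have ha : Continuous fun p : Sp n × (Fin n → ℝ) => a p.1 p.2 := by
    refine Continuous.matrix_mulVec ?_ continuous_snd
    exact (continuous_subtype_val.comp continuous_fst).matrix_submatrix _ _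
  have hc : Continuous fun p : Sp n × (Fin n → ℝ) => c p.1 p.2 := by
    refine Continuous.matrix_mulVec ?_ continuous_snd
    exact (continuous_subtype_val.comp continuous_fst).matrix_submatrix _ _
  -- The strict inequality holds at `g = 1`, and compactness of the sphere makes it uniform in `z`.
  -- Homogeneity extends it later to all vectors.
  have hev : ∀ᶠ g in 𝓝 (1 : Sp n), ∀ z ∈ Metric.sphere (0 : Fin n → ℝ) 1,
      c g z ⬝ᵥ c g z < δ * (a g z ⬝ᵥ a g z) := by
    refine (isCompact_sphere _ _).eventually_forall_of_forall_eventually fun z hz => ?_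
    refine IsOpen.mem_nhds (isOpen_lt (hc.dotProduct hc)
      (continuous_const.mul (ha.dotProduct ha))) ?_
    have ha1 : a 1 z = z := by
      change (1 : Matrix (Fin n ⊕ Fin n) (Fin n ⊕ Fin n) ℝ).toBlocks₁₁.mulVec z = z
      rw [← Matrix.fromBlocks_one, Matrix.toBlocks_fromBlocks₁₁, Matrix.one_mulVec]
    have hc1 : c 1 z = 0 := by
      change (1 : Matrix (Fin n ⊕ Fin n) (Fin n ⊕ Fin n) ℝ).toBlocks₂₁.mulVec z = 0
      rw [← Matrix.fromBlocks_one, Matrix.toBlocks_fromBlocks₂₁, Matrix.zero_mulVec]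
    change c 1 z ⬝ᵥ c 1 z < δ * (a 1 z ⬝ᵥ a 1 z)
    rw [ha1, hc1, dotProduct_zero]
    refine mul_pos hδ (lt_of_le_of_ne ?_ ?_)
    · simpa using dotProduct_self_star_nonneg z
    · intro h0
      rw [eq_comm, dotProduct_self_eq_zero] at h0
      simp [h0] at hz
  have himg := isOpenMap_smul_spanE.image_mem_nhds hev
  rw [one_smul] at himg
  refine mem_of_superset himg ?_
  rintro _ ⟨g, hg, rfl⟩ x y hxy
  obtain ⟨w, hw, hwxy⟩ := hxy
  obtain ⟨z, rfl⟩ := exists_elim_of_mem_spanE hw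
  rw [Matrix.mulVecLin_apply, mulVec_elim, Sum.elim_eq_iff, Matrix.mulVec_zero,
    Matrix.mulVec_zero, add_zero, add_zero] at hwxy
  obtain ⟨rfl, rfl⟩ := hwxy
  by_cases hz : z = 0
  · simp [hz]
  have hz' : ‖z‖ ≠ 0 := norm_ne_zero_iff.2 hz
  have h := hg (‖z‖⁻¹ • z) (by simp [norm_smul, hz'])
  simp only [a, c, Matrix.mulVec_smul, smul_dotProduct, dotProduct_smul, smul_eq_mul] at h
  have hpos : 0 < ‖z‖⁻¹ * ‖z‖⁻¹ := mul_self_pos.2 (inv_ne_zero hz')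
  refine le_of_mul_le_mul_left ?_ hpos
  linarith

/-- The shear fixing `Span(f)` and mapping `Span(e + f)` to `Span(e)`. -/
def shearSp (n : ℕ) : Sp n := ⟨Matrix.fromBlocks 1 0 (-1) 1, by
  rw [SymplecticGroup.mem_iff, Matrix.J, Matrix.fromBlocks_transpose,
    Matrix.fromBlocks_multiply, Matrix.fromBlocks_multiply]
  simp⟩

theorem shearSp_mulVec (x y : Fin n → ℝ) :
    (shearSp n).1.mulVec (Sum.elim x y) = Sum.elim x (y - x) := by
  simp [shearSp, mulVec_elim, Matrix.neg_mulVec, sub_eq_neg_add]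

theorem shearSp_smul_spanD : shearSp n • spanD n = spanE n := by
  refine Lag.smul_eq_of_forall fun x hx => ?_
  obtain ⟨z, rfl⟩ := exists_elim_of_mem_spanD hx
  rw [shearSp_mulVec, sub_self]
  exact elim_mem_spanE z

theorem real_dotProduct_self_nonneg (x : Fin n → ℝ) : 0 ≤ x ⬝ᵥ x := by
  simpa using dotProduct_self_star_nonneg x

theorem sq_le_dotProduct_self (x : Fin n → ℝ) (i : Fin n) : x i ^ 2 ≤ x ⬝ᵥ x := by
  rw [sq]
  exact Finset.single_le_sum (f := fun i => x i * x i) (fun j _ => mul_self_nonneg _)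
    (Finset.mem_univ i)

/-- The estimate behind the properness of the action on positive triples, for the images
`(p, r)` and `(q, s)` of a pair of conjugate vectors. -/
theorem dotProduct_bounds {p q r s : Fin n → ℝ} {N : ℝ} (hr : r ⬝ᵥ r ≤ 1 / 20 * (p ⬝ᵥ p))
    (hq : q ⬝ᵥ q ≤ 1 / 20 * (s ⬝ᵥ s))
    (ht : (r + s - (p + q)) ⬝ᵥ (r + s - (p + q)) ≤ 1 / 20 * ((p + q) ⬝ᵥ (p + q)))
    (hN : p ⬝ᵥ s - r ⬝ᵥ q = N) :
    p ⬝ᵥ p ≤ 4 * N ∧ q ⬝ᵥ q ≤ 4 * N ∧ r ⬝ᵥ r ≤ 4 * N ∧ s ⬝ᵥ s ≤ 4 * N := by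
  -- These squares control the cross terms: after expansion into inner products of `p, q, r, s`,
  -- each bound is a linear consequence.
  have h1 := real_dotProduct_self_nonneg (p - q)
  have h2 := real_dotProduct_self_nonneg (r - q)
  have h3 := real_dotProduct_self_nonneg ((r + s - (p + q)) - q)
  have h4 := real_dotProduct_self_nonneg ((r + s - (p + q)) + r)
  have h5 := real_dotProduct_self_nonneg (q + r)
  have hp := real_dotProduct_self_nonneg p
  have hs := real_dotProduct_self_nonneg s
  simp only [add_dotProduct, dotProduct_add, sub_dotProduct, dotProduct_sub,
    dotProduct_comm q p, dotProduct_comm r p, dotProduct_comm s p, dotProduct_comm r q,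
    dotProduct_comm s q, dotProduct_comm s r] at *
  refine ⟨?_, ?_, ?_, ?_⟩ <;> linarith

/-- Symplectic matrices that move the standard triple only a little are bounded. -/
theorem exists_nhds_abs_le (n : ℕ) : ∃ A ∈ 𝓝 (spanE n), ∃ B ∈ 𝓝 (spanD n), ∃ C ∈ 𝓝 (spanF n),
    ∀ g : Sp n, g • spanE n ∈ A → g • spanD n ∈ B → g • spanF n ∈ C →
      ∀ i j, |g.1 i j| ≤ 2 := by
  set A := {L : Lag n | ∀ x y : Fin n → ℝ, (Sum.elim x y : E n) ∈ L.1 →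
    y ⬝ᵥ y ≤ 1 / 20 * (x ⬝ᵥ x)}
  have hA : A ∈ 𝓝 (spanE n) := setOf_dotProduct_le_mem_nhds (by norm_num)
  -- The shear and the swap carry the other two standard Lagrangians to `spanE n`, so a single
  -- neighbourhood serves three times.
  refine ⟨A, hA, (fun L => shearSp n • L) ⁻¹' A, ?_, (fun L => swapSp n • L) ⁻¹' A, ?_,
    fun g hE hD hF => ?_⟩
  · exact (continuous_const_smul (shearSp n)).continuousAt.preimage_mem_nhds
      (by rwa [shearSp_smul_spanD])
  · exact (continuous_const_smul (swapSp n)).continuousAt.preimage_mem_nhds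
      (by rwa [swapSp_smul_spanF])
  have key : ∀ z : Fin n → ℝ,
      g.1.toBlocks₁₁.mulVec z ⬝ᵥ g.1.toBlocks₁₁.mulVec z ≤ 4 * (z ⬝ᵥ z) ∧
      g.1.toBlocks₁₂.mulVec z ⬝ᵥ g.1.toBlocks₁₂.mulVec z ≤ 4 * (z ⬝ᵥ z) ∧
      g.1.toBlocks₂₁.mulVec z ⬝ᵥ g.1.toBlocks₂₁.mulVec z ≤ 4 * (z ⬝ᵥ z) ∧
      g.1.toBlocks₂₂.mulVec z ⬝ᵥ g.1.toBlocks₂₂.mulVec z ≤ 4 * (z ⬝ᵥ z) := by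
    intro z
    have mE : g.1.mulVec (Sum.elim z 0) ∈ (g • spanE n).1 := ⟨_, elim_mem_spanE z, rfl⟩
    have mF : g.1.mulVec (Sum.elim 0 z) ∈ (g • spanF n).1 := ⟨_, elim_mem_spanF z, rfl⟩
    have mD : g.1.mulVec (Sum.elim z z) ∈ (g • spanD n).1 := ⟨_, elim_mem_spanD z, rfl⟩
    rw [mulVec_elim] at mE mF mD
    have mF' := Lag.mulVec_mem (g := swapSp n) rfl mF
    have mD' := Lag.mulVec_mem (g := shearSp n) rfl mD
    rw [swapSp_mulVec] at mF'
    rw [shearSp_mulVec] at mD'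
    have h1 := hE _ _ mE
    have h2 := hF _ _ mF'
    have h3 := hD _ _ mD'
    simp only [Matrix.mulVec_zero, add_zero, zero_add, neg_dotProduct_neg] at h1 h2
    refine dotProduct_bounds h1 h2 h3 ?_
    have h4 := omega_mulVec g (Sum.elim z 0) (Sum.elim 0 z)
    rw [mulVec_elim, mulVec_elim, omega_elim, omega_elim] at h4
    simpa using h4
  have hsq : ∀ {a : ℝ}, a ^ 2 ≤ 4 * 1 → |a| ≤ 2 := fun {a} h =>
    abs_le_of_sq_le_sq (by linarith) (by norm_num)
  have hcol : ∀ (M : Matrix (Fin n) (Fin n) ℝ) (i j : Fin n),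
      (∀ z, M.mulVec z ⬝ᵥ M.mulVec z ≤ 4 * (z ⬝ᵥ z)) → |M i j| ≤ 2 := by
    intro M i j h
    have h1 := h (Pi.single j 1)
    have h2 := sq_le_dotProduct_self (M.mulVec (Pi.single j 1)) i
    simp only [Matrix.mulVec_single_one, dotProduct_single, Pi.single_eq_same, mul_one] at h1 h2
    exact hsq (by simpa using h2.trans h1)
  rintro (i | i) (j | j)
  · exact hcol _ i j fun z => (key z).1
  · exact hcol _ i j fun z => (key z).2.1
  · exact hcol _ i j fun z => (key z).2.2.1
  · exact hcol _ i j fun z => (key z).2.2.2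

theorem isCompact_setOf_abs_le (n : ℕ) : IsCompact {g : Sp n | ∀ i j, |g.1 i j| ≤ 2} := by
  have hclosed : IsClosed {M : Matrix (Fin n ⊕ Fin n) (Fin n ⊕ Fin n) ℝ |
      M ∈ Matrix.symplecticGroup (Fin n) ℝ} := by
    simp only [SymplecticGroup.mem_iff]
    exact isClosed_eq (by fun_prop) continuous_const
  have hcompact : IsCompact {M : Matrix (Fin n ⊕ Fin n) (Fin n ⊕ Fin n) ℝ |
      ∀ i j, |M i j| ≤ 2} := by
    have heq : {M : Matrix (Fin n ⊕ Fin n) (Fin n ⊕ Fin n) ℝ | ∀ i j, |M i j| ≤ 2} =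
        (show Set (Matrix (Fin n ⊕ Fin n) (Fin n ⊕ Fin n) ℝ) from
          Set.univ.pi fun _ => Set.univ.pi fun _ => Set.Icc (-2 : ℝ) 2) := by
      ext M
      simp only [Set.mem_ofPred_eq, abs_le]
      exact ⟨fun h i _ j _ => h i j, fun h i j => h i trivial j trivial⟩
    rw [heq]
    exact isCompact_univ_pi fun _ => isCompact_univ_pi fun _ => isCompact_Icc
  exact hclosed.isClosedEmbedding_subtypeVal.isCompact_preimage hcompact

end Grassmannian

/-! ### Topology of the moduli space -/

namespace FramedLocalSystem

variable {T : IdealTriangulation V} {n : ℕ}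

theorem continuous_tuple :
    Continuous fun F : FramedLocalSystem T n => (F.edge, F.tri, F.Lt, F.Lb) :=
  continuous_induced_dom

theorem continuous_edge (a : T.A₂) : Continuous fun F : FramedLocalSystem T n => F.edge a :=
  (continuous_apply a).comp (continuous_fst.comp continuous_tuple)

theorem continuous_tri (v : V) : Continuous fun F : FramedLocalSystem T n => F.tri v :=
  (continuous_apply v).comp (continuous_fst.comp (continuous_snd.comp continuous_tuple))

theorem continuous_Lt (v : V) : Continuous fun F : FramedLocalSystem T n => F.Lt v :=
  (continuous_apply v).comp
    (continuous_fst.comp (continuous_snd.comp (continuous_snd.comp continuous_tuple)))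

theorem continuous_Lb (v : V) : Continuous fun F : FramedLocalSystem T n => F.Lb v :=
  (continuous_apply v).comp
    (continuous_snd.comp (continuous_snd.comp (continuous_snd.comp continuous_tuple)))

theorem continuous_gauge (ψ : V → Sp n) :
    Continuous (gauge ψ : FramedLocalSystem T n → FramedLocalSystem T n) := by
  refine continuous_induced_rng.2 (.prodMk ?_ (.prodMk ?_ (.prodMk ?_ ?_)))
  · exact continuous_pi fun a => (continuous_const.mul (continuous_edge a)).mul continuous_const
  · exact continuous_pi fun v => (continuous_const.mul (continuous_tri v)).mul continuous_const
  · exact continuous_pi fun v => (continuous_Lt v).const_smul (ψ v)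
  · exact continuous_pi fun v => (continuous_Lb v).const_smul (ψ v)

/-- Equivalence is the orbit relation of gauge transformations, each of which acts continuously. -/
theorem isOpenMap_mk : IsOpenMap (Quotient.mk (setoid T n)) := by
  intro U hU
  have : Quotient.mk (setoid T n) ⁻¹' (Quotient.mk (setoid T n) '' U) =
      ⋃ ψ : V → Sp n, gauge ψ ⁻¹' U := by
    ext F
    simp only [Set.mem_preimage, Set.mem_image, Set.mem_iUnion]
    constructor
    · rintro ⟨F', hF', h⟩
      obtain ⟨ψ, rfl⟩ := equivalent_iff.1 (Quotient.exact h.symm)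
      exact ⟨ψ, hF'⟩
    · rintro ⟨ψ, h⟩
      exact ⟨_, h, mk_gauge ψ F⟩
  refine isQuotientMap_quotient_mk'.isOpen_preimage.1 ?_
  change IsOpen (Quotient.mk (setoid T n) ⁻¹' (Quotient.mk (setoid T n) '' U))
  rw [this]
  exact isOpen_iUnion fun ψ => hU.preimage (continuous_gauge ψ)

end FramedLocalSystem

open FramedLocalSystem

section Properness

variable {T : IdealTriangulation V} {n : ℕ}

theorem continuous_holSystem :
    Continuous fun x : XPlusDelta T n => holSystem T x.1 := by
  have hx : ∀ a i, Continuous fun x : XPlusDelta T n => x.1.1.1 a i i := fun a i =>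
    ((continuous_apply a).comp (continuous_fst.comp
      (continuous_subtype_val.comp continuous_subtype_val))).matrix_elem i i
  have hu : ∀ v, Continuous fun x : XPlusDelta T n => (x.1.1.2 v).1 := fun v =>
    continuous_subtype_val.comp ((continuous_apply v).comp (continuous_snd.comp
      (continuous_subtype_val.comp continuous_subtype_val)))
  refine continuous_induced_rng.2 (.prodMk ?_ (.prodMk ?_ (.prodMk ?_ ?_)))
  · refine continuous_pi fun a => continuous_induced_rng.2 ?_
    have : (Subtype.val ∘ fun x : XPlusDelta T n => (holSystem T x.1).edge a) = fun x =>
        Matrix.fromBlocks 0 (-Matrix.diagonal fun i => (√(x.1.1.1 a i i))⁻¹)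
          (Matrix.diagonal fun i => √(x.1.1.1 a i i)) 0 :=
      funext fun x => edgeMatrix_of_mem_delta (x.1.2.1 a) (x.2 a)
    rw [this]
    have hinv : Continuous fun x : XPlusDelta T n =>
        Matrix.diagonal fun i => (√(x.1.1.1 a i i))⁻¹ :=
      Continuous.matrix_diagonal (continuous_pi fun i => (hx a i).sqrt.inv₀ fun x =>
        (Real.sqrt_pos.2 (diag_pos_of_mem_delta (x.2 a) i)).ne')
    exact Continuous.matrix_fromBlocks continuous_const hinv.neg
      (Continuous.matrix_diagonal (continuous_pi fun i => (hx a i).sqrt)) continuous_const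
  · refine continuous_pi fun v => continuous_induced_rng.2 ?_
    exact Continuous.matrix_fromBlocks (hu v) (hu v).neg (hu v) continuous_const
  · exact continuous_const
  · exact continuous_const

/-- Coordinates converge as soon as the transition matrices do. -/
theorem exists_tendsto_of_tendsto_holSystem {ι : Type*} {l : Filter ι} [NeBot l]
    {ξ : ι → XPlusDelta T n} {A : T.A₂ → Sp n} {B : V → Sp n}
    (hA : ∀ a, Tendsto (fun i => (holSystem T (ξ i).1).edge a) l (𝓝 (A a)))
    (hB : ∀ v, Tendsto (fun i => (holSystem T (ξ i).1).tri v) l (𝓝 (B v))) :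
    ∃ x₀, Tendsto ξ l (𝓝 x₀) := by
  have hA' : ∀ a p q, Tendsto (fun i => ((holSystem T (ξ i).1).edge a).1 p q) l
      (𝓝 ((A a).1 p q)) := fun a p q =>
    (((continuous_id.matrix_elem p q).comp continuous_subtype_val).tendsto _).comp (hA a)
  have hedge : ∀ i a, ((holSystem T (ξ i).1).edge a).1 = Matrix.fromBlocks 0
      (-Matrix.diagonal fun j => (√((ξ i).1.1.1 a j j))⁻¹)
      (Matrix.diagonal fun j => √((ξ i).1.1.1 a j j)) 0 := fun i a =>
    edgeMatrix_of_mem_delta ((ξ i).1.2.1 a) ((ξ i).2 a)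
  let s : T.A₂ → Fin n → ℝ := fun a j => (A a).1 (Sum.inr j) (Sum.inl j)
  have hs : ∀ a j, Tendsto (fun i => √((ξ i).1.1.1 a j j)) l (𝓝 (s a j)) := by
    intro a j
    simpa [hedge] using hA' a (Sum.inr j) (Sum.inl j)
  -- The square roots and their inverses both occur as matrix entries and both converge, so the
  -- limit cannot degenerate to `0`.
  have hs_pos : ∀ a j, 0 < s a j := by
    intro a j
    have h1 : Tendsto (fun i => (√((ξ i).1.1.1 a j j))⁻¹) l
        (𝓝 (-(A a).1 (Sum.inl j) (Sum.inr j))) := by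
      simpa [hedge] using (hA' a (Sum.inl j) (Sum.inr j)).neg
    have h2 := (hs a j).mul h1
    have h3 : (fun i => √((ξ i).1.1.1 a j j) * (√((ξ i).1.1.1 a j j))⁻¹) = fun _ => (1 : ℝ) :=
      funext fun i => mul_inv_cancel₀ (Real.sqrt_pos.2 (diag_pos_of_mem_delta ((ξ i).2 a) j)).ne'
    rw [h3] at h2
    have h4 := tendsto_nhds_unique h2 tendsto_const_nhds
    refine lt_of_le_of_ne (ge_of_tendsto' (hs a j) fun i => Real.sqrt_nonneg _) fun h0 => ?_
    rw [← h0, zero_mul] at h4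
    exact zero_ne_one h4
  have hd : ∀ a j, Tendsto (fun i => (ξ i).1.1.1 a j j) l (𝓝 (s a j * s a j)) := by
    intro a j
    refine ((hs a j).mul (hs a j)).congr fun i => ?_
    exact Real.mul_self_sqrt (diag_pos_of_mem_delta ((ξ i).2 a) j).le
  have hS : ∀ a, Tendsto (fun i => (ξ i).1.1.1 a) l
      (𝓝 (Matrix.diagonal fun j => s a j * s a j)) := by
    intro a
    have h1 : (fun i => (ξ i).1.1.1 a) = fun i => Matrix.diagonal fun j => (ξ i).1.1.1 a j j :=
      funext fun i => eq_diagonal_of_mem_delta ((ξ i).2 a)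
    rw [h1]
    exact ((Continuous.matrix_diagonal continuous_id).tendsto _).comp (tendsto_pi_nhds.2 (hd a))
  have hU : ∀ v, Tendsto (fun i => ((ξ i).1.1.2 v).1) l (𝓝 (B v).1.toBlocks₁₁) := fun v =>
    ((continuous_subtype_val.matrix_submatrix Sum.inl Sum.inl).tendsto (B v)).comp (hB v)
  have hO : ∀ v, (B v).1.toBlocks₁₁ ∈ Matrix.orthogonalGroup (Fin n) ℝ := by
    intro v
    rw [Matrix.mem_orthogonalGroup_iff]
    have hc : Continuous fun M : Matrix (Fin n) (Fin n) ℝ => M * M.transpose := by fun_prop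
    have h1 := (hc.tendsto _).comp (hU v)
    have h2 : ((fun M : Matrix (Fin n) (Fin n) ℝ => M * M.transpose) ∘
        fun i => ((ξ i).1.1.2 v).1) = fun _ => 1 := funext fun i => ((ξ i).1.1.2 v).mul_transpose
    rw [h2] at h1
    exact tendsto_nhds_unique h1 tendsto_const_nhds
  let u : V → On n := fun v => ⟨_, hO v⟩
  have hu : ∀ v, Tendsto (fun i => (ξ i).1.1.2 v) l (𝓝 (u v)) := fun v =>
    tendsto_subtype_rng.2 (hU v)
  have hpos : ∀ a j, 0 < s a j * s a j := fun a j => mul_pos (hs_pos a j) (hs_pos a j)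
  let x₀ : XPlusDelta T n := ⟨⟨(fun a => Matrix.diagonal fun j => s a j * s a j, u),
    fun a => Matrix.posDef_diagonal_iff.2 (hpos a), fun a => ?_, fun v => ?_⟩,
    fun a => ⟨_, hpos a, fun j k hjk => ?_, rfl⟩⟩
  · refine ⟨x₀, tendsto_subtype_rng.2 (tendsto_subtype_rng.2 ?_)⟩
    exact (tendsto_pi_nhds.2 hS).prodMk_nhds (tendsto_pi_nhds.2 hu)
  · refine tendsto_nhds_unique (hS (rev a)) ((hS a).congr fun i => ?_)
    exact ((ξ i).1.2.2.1 a).symm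
  · have h1 := ((hu (T.next (T.next v))).mul (hu (T.next v))).mul (hu v)
    simp only [(ξ _).1.2.2.2 v] at h1
    exact tendsto_nhds_unique h1 tendsto_const_nhds
  · exact le_of_tendsto_of_tendsto' (hd a j) (hd a k) fun i =>
      diag_monotone_of_mem_delta ((ξ i).2 a) hjk

/-- The core of properness. Gauges may escape to infinity a priori, but convergence of the gauged
faces confines each of them to a compact set. Removing the limiting gauges shows that the
coordinates converge. -/
theorem tendsto_nhds_holDelta_of_ultrafilter (𝒰 : Ultrafilter (XPlusDelta T n))
    (x₁ : XPlusDelta T n) (h : Tendsto (holDelta T n) 𝒰 (𝓝 (holDelta T n x₁))) :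
    ∃ x₀, holDelta T n x₀ = holDelta T n x₁ ∧ (𝒰 : Filter (XPlusDelta T n)) ≤ 𝓝 x₀ := by
  set F₁ := holSystem T x₁.1 with hF₁
  let Φ : XPlusDelta T n × (V → Sp n) → FramedLocalSystem T n :=
    fun p => gauge p.2 (holSystem T p.1.1)
  -- Openness of the quotient map provides, for coordinates whose class is close to the limit class,
  -- a gauge bringing the system close to `F₁`.
  have hne : NeBot (comap Prod.fst (𝒰 : Filter (XPlusDelta T n)) ⊓ comap Φ (𝓝 F₁)) := by
    rw [inf_neBot_iff]
    rintro s ⟨A, hA, hAs⟩ t ⟨N, hN, hNt⟩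
    have hN' : Quotient.mk (setoid T n) '' N ∈ 𝓝 (holDelta T n x₁) :=
      isOpenMap_mk.image_mem_nhds hN
    obtain ⟨x, hxA, F, hFN, hF⟩ := ((show ∀ᶠ x in (𝒰 : Filter _), x ∈ A from hA).and
      (h hN')).exists
    obtain ⟨ψ, rfl⟩ := equivalent_iff.1 (Quotient.exact hF.symm)
    exact ⟨(x, ψ), hAs hxA, hNt hFN⟩
  let 𝒲 := Ultrafilter.of (comap Prod.fst (𝒰 : Filter (XPlusDelta T n)) ⊓ comap Φ (𝓝 F₁))
  have h𝒲 := Ultrafilter.of_le (comap Prod.fst (𝒰 : Filter (XPlusDelta T n)) ⊓ comap Φ (𝓝 F₁))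
  have hfst : Tendsto Prod.fst (𝒲 : Filter (XPlusDelta T n × (V → Sp n))) 𝒰 :=
    tendsto_comap.mono_left (h𝒲.trans inf_le_left)
  have hΦ : Tendsto Φ 𝒲 (𝓝 F₁) := tendsto_comap.mono_left (h𝒲.trans inf_le_right)
  have hLt : ∀ v, Tendsto (fun p => (Φ p).Lt v) 𝒲 (𝓝 (spanE n)) := fun v =>
    ((continuous_Lt v).tendsto F₁).comp hΦ
  have hLb : ∀ v, Tendsto (fun p => (Φ p).Lb v) 𝒲 (𝓝 (spanF n)) := fun v =>
    ((continuous_Lb v).tendsto F₁).comp hΦ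
  have htri : ∀ v, Tendsto (fun p => (Φ p).tri v) 𝒲 (𝓝 (F₁.tri v)) := fun v =>
    ((continuous_tri v).tendsto F₁).comp hΦ
  have hedge : ∀ a, Tendsto (fun p => (Φ p).edge a) 𝒲 (𝓝 (F₁.edge a)) := fun a =>
    ((continuous_edge a).tendsto F₁).comp hΦ
  -- The third vertex of the face is not part of the framing at `v`. It is seen by transporting `Lt`
  -- along the arrow that ends at `v`.
  have hD : ∀ v, Tendsto (fun p : XPlusDelta T n × (V → Sp n) => p.2 v • spanD n) 𝒲
      (𝓝 (spanD n)) := by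
    intro v
    have h1 := tendsto_smul_lag (htri (T.next (T.next v))) (hLt (T.next (T.next v)))
    have h2 : F₁.tri (T.next (T.next v)) • spanE n = spanD n := triMatrix_smul_spanE _
    rw [h2] at h1
    refine h1.congr fun p => ?_
    simp only [Φ, gauge_tri, gauge_Lt, T.next_next_next]
    rw [← mul_smul, inv_mul_cancel_right, mul_smul]
    exact congrArg _ (triMatrix_smul_spanE _)
  obtain ⟨A, hA, B, hB, C, hC, hABC⟩ := exists_nhds_abs_le n
  have hK : ∀ v, ∀ᶠ p in (𝒲 : Filter (XPlusDelta T n × (V → Sp n))),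
      p.2 v ∈ {g : Sp n | ∀ i j, |g.1 i j| ≤ 2} := by
    intro v
    filter_upwards [hLt v hA, hD v hB, hLb v hC] with p h1 h2 h3
    exact hABC _ h1 h2 h3
  have hψ : ∀ v, ∃ g : Sp n, Tendsto (fun p : XPlusDelta T n × (V → Sp n) => p.2 v) 𝒲 (𝓝 g) := by
    intro v
    obtain ⟨g, -, hg⟩ := (isCompact_setOf_abs_le n).ultrafilter_le_nhds 
      (𝒲.map fun p : XPlusDelta T n × (V → Sp n) => p.2 v) (le_principal_iff.2 (hK v))
    exact ⟨g, hg⟩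
  choose ψ₀ hψ₀ using hψ
  have hedge' : ∀ a, Tendsto (fun p : XPlusDelta T n × (V → Sp n) => (holSystem T p.1.1).edge a) 𝒲
      (𝓝 ((ψ₀ (tgt a))⁻¹ * F₁.edge a * ψ₀ (src a))) := fun a => by
    refine (((hψ₀ (tgt a)).inv.mul (hedge a)).mul (hψ₀ (src a))).congr fun p => ?_
    rw [gauge_edge]
    group
  have htri' : ∀ v, Tendsto (fun p : XPlusDelta T n × (V → Sp n) => (holSystem T p.1.1).tri v) 𝒲
      (𝓝 ((ψ₀ (T.next v))⁻¹ * F₁.tri v * ψ₀ v)) := fun v => by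
    refine (((hψ₀ (T.next v)).inv.mul (htri v)).mul (hψ₀ v)).congr fun p => ?_
    rw [gauge_tri]
    group
  obtain ⟨x₀, hx₀⟩ := exists_tendsto_of_tendsto_holSystem hedge' htri'
  have hlim := (continuous_holSystem.tendsto x₀).comp hx₀
  refine ⟨x₀, Quotient.sound (equivalent_iff.2 ⟨ψ₀, FramedLocalSystem.ext (funext fun a => ?_)
    (funext fun v => ?_) (funext fun v => ?_) (funext fun v => ?_)⟩), ?_⟩
  · refine tendsto_nhds_unique ?_ (hedge a)
    exact ((hψ₀ _).mul (((continuous_edge a).tendsto _).comp hlim)).mul (hψ₀ _).inv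
  · refine tendsto_nhds_unique ?_ (htri v)
    exact ((hψ₀ _).mul (((continuous_tri v).tendsto _).comp hlim)).mul (hψ₀ _).inv
  · exact smul_spanE_eq_of_tendsto (hψ₀ v) (hLt v)
  · exact smul_spanF_eq_of_tendsto (hψ₀ v) (hLb v)
  -- Comparable ultrafilters are equal, so convergence along the auxiliary ultrafilter descends to
  -- `𝒰`.
  · have : 𝒲.map Prod.fst = 𝒰 := Ultrafilter.coe_le_coe.1 hfst
    rw [← this]
    exact hx₀

theorem holDelta_mem_maximalModuli (x : XPlusDelta T n) : holDelta T n x ∈ maximalModuli T n :=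
  ⟨_, holSystem_isMaximal T x.1, rfl⟩

theorem holDeltaMax_surjective [Finite V]
    (h : ∀ x : XPlusDelta T n, holDelta T n x ∈ maximalModuli T n) :
    Function.Surjective (holDeltaMax T n h) := by
  rintro ⟨_, F, hF, rfl⟩
  obtain ⟨x, hx⟩ := F.exists_holSystem_equivalent hF.posAt
  exact ⟨x, Subtype.ext hx⟩

theorem isProperMap_holDeltaMax [Finite V]
    (h : ∀ x : XPlusDelta T n, holDelta T n x ∈ maximalModuli T n) :
    IsProperMap (holDeltaMax T n h) := by
  rw [isProperMap_iff_ultrafilter]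
  refine ⟨?_, fun 𝒰 y hy => ?_⟩
  · exact (continuous_quotient_mk'.comp continuous_holSystem).codRestrict h
  -- By surjectivity the limit class has a normalized representative.
  · obtain ⟨x₁, rfl⟩ := holDeltaMax_surjective h y
    obtain ⟨x₀, hx₀, hle⟩ := tendsto_nhds_holDelta_of_ultrafilter 𝒰 x₁
      ((continuous_subtype_val.tendsto _).comp hy)
    exact ⟨x₀, Subtype.ext hx₀, hle⟩

end Properness

/-! ### Generic finiteness -/

section Generic

variable {T : IdealTriangulation V} {n : ℕ}

/-- Coordinates whose diagonal matrices have simple spectrum. -/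
def simpleSpectrum (T : IdealTriangulation V) (n : ℕ) : Set (XPlusDelta T n) :=
  {x | ∀ a i j, i ≠ j → x.1.1.1 a i i ≠ x.1.1.1 a j j}

theorem isOpen_simpleSpectrum [Finite V] : IsOpen (simpleSpectrum T n) := by
  simp only [simpleSpectrum, Set.ofPred_forall]
  refine isOpen_iInter_of_finite fun a => isOpen_iInter_of_finite fun i =>
    isOpen_iInter_of_finite fun j => isOpen_iInter_of_finite fun _ => ?_
  have hx : ∀ i, Continuous fun x : XPlusDelta T n => x.1.1.1 a i i := fun i =>
    ((continuous_apply a).comp (continuous_fst.comp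
      (continuous_subtype_val.comp continuous_subtype_val))).matrix_elem i i
  exact isOpen_ne_fun (hx i) (hx j)

/-- The perturbation adding `t * i` to the `i`-th diagonal entries. -/
def spread (x : XPlusDelta T n) (t : Set.Ici (0 : ℝ)) : XPlusDelta T n :=
  have hpos : ∀ a i, 0 < x.1.1.1 a i i + t.1 * i := fun a i =>
    add_pos_of_pos_of_nonneg (diag_pos_of_mem_delta (x.2 a) i)
      (mul_nonneg t.2 (Nat.cast_nonneg _))
  ⟨⟨(fun a => Matrix.diagonal fun i => x.1.1.1 a i i + t.1 * i, x.1.1.2),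
    fun a => Matrix.posDef_diagonal_iff.2 (hpos a), fun a => by simp only [x.1.2.2.1 a],
    x.1.2.2.2⟩,
    fun a => ⟨_, hpos a, fun i j hij => add_le_add (diag_monotone_of_mem_delta (x.2 a) hij)
      (mul_le_mul_of_nonneg_left (Nat.cast_le.2 hij) t.2), rfl⟩⟩

theorem spread_zero (x : XPlusDelta T n) : spread x ⟨0, Set.self_mem_Ici⟩ = x := by
  refine Subtype.ext (Subtype.ext (Prod.ext (funext fun a => ?_) rfl))
  simp only [spread, zero_mul, add_zero]
  exact (eq_diagonal_of_mem_delta (x.2 a)).symm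

theorem continuous_spread (x : XPlusDelta T n) : Continuous (spread x) := by
  refine continuous_induced_rng.2 (continuous_induced_rng.2 (.prodMk ?_ continuous_const))
  refine continuous_pi fun a => Continuous.matrix_diagonal (continuous_pi fun i => ?_)
  exact continuous_const.add (continuous_subtype_val.mul continuous_const)

theorem spread_mem_simpleSpectrum (x : XPlusDelta T n) {t : Set.Ici (0 : ℝ)} (ht : 0 < t.1) :
    spread x t ∈ simpleSpectrum T n := by
  intro a i j hij
  have hmono : StrictMono fun i : Fin n => x.1.1.1 a i i + t.1 * (i : ℕ) := fun i j hij =>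
    add_lt_add_of_le_of_lt (diag_monotone_of_mem_delta (x.2 a) hij.le)
      (mul_lt_mul_of_pos_left (Nat.cast_lt.2 hij) ht)
  simpa [spread] using hmono.injective.ne hij

theorem dense_simpleSpectrum : Dense (simpleSpectrum T n) := by
  intro x
  let t : ℕ → Set.Ici (0 : ℝ) := fun k => ⟨1 / ((k : ℝ) + 1), by
    rw [Set.mem_Ici]; positivity⟩
  have ht : Tendsto t atTop (𝓝 ⟨0, Set.self_mem_Ici⟩) :=
    tendsto_subtype_rng.2 tendsto_one_div_add_atTop_nhds_zero_nat
  have h := ((continuous_spread x).tendsto _).comp ht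
  rw [spread_zero] at h
  exact mem_closure_of_tendsto h (Eventually.of_forall fun k =>
    spread_mem_simpleSpectrum x (by simp only [t]; positivity))

/-- Orthogonal matrices that are diagonal form a finite set. -/
theorem finite_setOf_diagonal_orthogonal (n : ℕ) :
    {r : On n | ∀ i j, i ≠ j → r.1 i j = 0}.Finite := by
  have hfin : (Set.univ.pi fun _ : Fin n => ({1, -1} : Set ℝ)).Finite :=
    Set.Finite.pi fun _ => Set.toFinite _
  refine Set.Finite.of_finite_image (f := fun r : On n => fun i => r.1 i i)
    (hfin.subset ?_) ?_
  · rintro _ ⟨r, hr, rfl⟩ i -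
    have h := congrFun (congrFun r.mul_transpose i) i
    rw [Matrix.mul_apply, Finset.sum_eq_single i (fun j _ hj => by rw [hr i j hj.symm, zero_mul])
      (by simp), Matrix.transpose_apply, Matrix.one_apply_eq] at h
    exact mul_self_eq_one_iff.1 h
  · intro r hr s hs hrs
    refine Subtype.ext ?_
    ext i j
    by_cases hij : i = j
    · subst hij
      exact congrFun hrs i
    · rw [hr i j hij, hs i j hij]

/-- Every side carries an edge matrix with simple spectrum, and an orthogonal matrix commuting with
it is diagonal. The gauges therefore range over a finite set, and each determines the other point of
the fibre. -/
theorem finite_fibre [Finite V] (hT : ∀ v : V, T.opp v ≠ v) {x : XPlusDelta T n}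
    (hx : x ∈ simpleSpectrum T n) : {x' | holDelta T n x = holDelta T n x'}.Finite := by
  have hR : {r : V → On n | ∀ v i j, i ≠ j → (r v).1 i j = 0}.Finite := by
    have := Set.Finite.pi' fun _ : V => finite_setOf_diagonal_orthogonal n
    exact this
  refine Set.Finite.of_finite_image (f := fun x' => x'.1.1)
    ((hR.image fun r => (x.1.1.1, fun v => r (T.next v) * x.1.1.2 v * (r v)⁻¹)).subset ?_)
    (fun x' _ x'' _ h => Subtype.ext (Subtype.ext h))
  rintro _ ⟨x', hx', rfl⟩
  obtain ⟨h1, r, h2, h3⟩ := (holDelta_eq_iff x x').1 hx'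
  refine ⟨r, fun v i j hij => ?_, Prod.ext (funext h1) (funext fun v => (h3 v).symm)⟩
  by_contra h0
  exact hx ⟨v, hT v⟩ i j hij
    ((commute_iff_of_mem_delta (x.2 ⟨v, hT v⟩) _).1 (h2 ⟨v, hT v⟩).2 i j h0)

/-- The edge coordinates are constant on fibres, so the simple-spectrum locus is saturated. Its
complement is closed and has closed image because a proper map is closed. Density in the target
follows from density in the source by continuity and surjectivity. -/
theorem genericallyFiniteToOne_holDeltaMax [Finite V] (hT : ∀ v : V, T.opp v ≠ v)
    (h : ∀ x : XPlusDelta T n, holDelta T n x ∈ maximalModuli T n) :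
    GenericallyFiniteToOne (holDeltaMax T n h) := by
  have hsurj := holDeltaMax_surjective h
  have hproper := isProperMap_holDeltaMax h
  have hsat : ∀ x x', holDeltaMax T n h x = holDeltaMax T n h x' →
      x ∈ simpleSpectrum T n → x' ∈ simpleSpectrum T n := by
    intro x x' hxx' hx a i j hij
    rw [← ((holDelta_eq_iff x x').1 (congrArg Subtype.val hxx')).1 a]
    exact hx a i j hij
  have hpre : holDeltaMax T n h ⁻¹' (holDeltaMax T n h '' (simpleSpectrum T n)ᶜ)ᶜ =
      simpleSpectrum T n := by
    ext x
    simp only [Set.mem_preimage, Set.mem_compl_iff, Set.mem_image, not_exists, not_and]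
    refine ⟨fun hx => by_contra fun hx' => hx x hx' rfl, fun hx x' hx' hxx' => ?_⟩
    exact hx' (hsat x x' hxx'.symm hx)
  refine ⟨(holDeltaMax T n h '' (simpleSpectrum T n)ᶜ)ᶜ, ?_, ?_, ?_, ?_⟩
  · exact (hproper.isClosedMap _ isOpen_simpleSpectrum.isClosed_compl).isOpen_compl
  · rw [← Set.image_preimage_eq (holDeltaMax T n h '' (simpleSpectrum T n)ᶜ)ᶜ hsurj, hpre]
    exact hsurj.denseRange.dense_image hproper.continuous dense_simpleSpectrum
  · rw [hpre]
    exact dense_simpleSpectrum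
  · intro y hy
    obtain ⟨x, rfl⟩ := hsurj y
    have hx : x ∈ simpleSpectrum T n := by rw [← hpre]; exact hy
    exact (finite_fibre hT hx).subset fun x' hx' => (congrArg Subtype.val hx').symm

end Generic

end FramedSp

end

theorem mainTheorem1 {V : Type*} [Finite V] [Nonempty V] (T : IdealTriangulation V) (n : ℕ) :
    ∃ h : ∀ x : XPlusDelta T n, holDelta T n x ∈ maximalModuli T n,
      Function.Surjective (holDeltaMax T n h) ∧
      (∀ x x' : XPlusDelta T n, holDeltaMax T n h x = holDeltaMax T n h x' ↔
        (∀ a : T.A₂, x.1.1.1 a = x'.1.1.1 a) ∧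
        ∃ r : V → On n,
          (∀ a : T.A₂, r (src a) = r (tgt a) ∧
            Commute (r (src a) : Matrix (Fin n) (Fin n) ℝ) (x.1.1.1 a)) ∧
          ∀ v : V, x'.1.1.2 v = r (T.next v) * x.1.1.2 v * (r v)⁻¹) ∧
      IsProperMap (holDeltaMax T n h) ∧
      ((∀ v : V, T.opp v ≠ v) → GenericallyFiniteToOne (holDeltaMax T n h)) := by
  have h : ∀ x : XPlusDelta T n, holDelta T n x ∈ maximalModuli T n := holDelta_mem_maximalModuli
  refine ⟨h, holDeltaMax_surjective h, fun x x' => ?_, isProperMap_holDeltaMax h,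
    fun hT => genericallyFiniteToOne_holDeltaMax hT h⟩
  rw [← holDelta_eq_iff x x']
  exact Subtype.ext_iff
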